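/- Let $I$ be a finite set and $A=(a_{ij})_{i,j\in I}$ a symmetrizable generalized Cartan matrix. Let $W$ be its Weyl group, acting on the root lattice $Q=\bigoplus_j\mathbb Z\alpha_j$ by the simple reflections $s_i(\alpha_j)=\alpha_j-a_{ij}\alpha_i$, and for $w\in W$ let $R(w)$ be the set of reduced words of $w$. Let $T$ be an algebraic torus over $\mathbb C$ with co-characters $\alpha_i^\vee$ (simple co-roots) and characters $\alpha_i$ (simple roots) such that $\langle\alpha_i^\vee,\alpha_j\rangle=a_{ij}$; for instance, $T$ is the maximal torus $\prod_i\alpha_i^\vee(\mathbb C^\times)$ of the Kac–Moody group of $A$. For a word $\mathbf i=(i_1,\dots,i_l)$ put $\alpha^{(k)}=s_{i_l}\cdots s_{i_{k+1}}(\alpha_{i_k})\in Q$, which is also regarded as a character of $T$. For a torus $S$ let $X_*(S)$ be its lattice of co-characters. A *geometric crystal* $\chi=(X,\gamma,\{e_i\}_{i\in I})$ consists of an ind-variety $X$ over $\mathbb C$, a rational morphism $\gamma:X\to T$ and rational actions $e_i:\mathbb C^\times\times X\to X$, $(c,x)\mapsto e_i^c(x)$ (that is, $e_i^1(x)=x$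 and $e_i^{c_1}e_i^{c_2}=e_i^{c_1c_2}$ as rational morphisms), such that $\gamma(e_i^c(x))=\alpha_i^\vee(c)\gamma(x)$ and such that for all $w\in W$ and $\mathbf i,\mathbf i'\in R(w)$ one has $e_{\mathbf i}=e_{\mathbf i'}$, where $e_{\mathbf i}:T\times X\to X$ is the rational morphism $(t,x)\mapsto e_{i_1}^{\alpha^{(1)}(t)}\cdots e_{i_l}^{\alpha^{(l)}(t)}(x)$. A rational morphism $f:S\to S'$ of tori is *positive* if, for each character $\mu$ of $S'$, the rational function $\mu\circ f$ on $S$ is a quotient of two nonzero polynomials, with nonnegative real coefficients, in the coordinates of $S\cong(\mathbb C^\times)^n$. The *ultra-discretization* $\deg(f):X_*(S)\to X_*(S')$ of such an $f$ is the map induced by $f$ on the irreducible components of the spaces of formal loops: a formal loop on $S\cong(\mathbb C^\times)^n$ is a point $\phi=(\phi_1,\dots,\phi_n)$ of $S$ over $\mathbb C((c))$, its degree is $(-\operatorname{ord}_c\phi_k)_k\in\mathbb Z^n=X_*(S)$, the loops of a given degree form one component, and $\deg(f)(\lambda)$ is the degree of $f(\phi)$ for a generic loop $\phi$ of degree $\lambda$.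 A *positive structure* on $\chi$ is a birational isomorphism $\theta:T'\to X$ from an algebraic torus $T'$ such that $\gamma\circ\theta:T'\to T$ and $e_{i,\theta}:\mathbb C^\times\times T'\to T'$, $(c,t)\mapsto\theta^{-1}(e_i^c(\theta(t)))$, for all $i\in I$, are positive. Given $\theta$, put $\tilde\gamma=\deg(\gamma\circ\theta):X_*(T')\to X_*(T)$ and $\tilde e_i=\deg(e_{i,\theta}):\mathbb Z\times X_*(T')\to X_*(T')$, $(n,b)\mapsto\tilde e_i^{\,n}(b)$. **Theorem.** For every geometric crystal $\chi=(X,\gamma,\{e_i\}_{i\in I})$ and every positive structure $\theta:T'\to X$ on $\chi$, the triple $(X_*(T'),\tilde\gamma,\{\tilde e_i\}_{i\in I})$ is a free $W$-crystal. That is: for each $i$ the map $\tilde e_i^{\,1}$ is a bijection of $X_*(T')$, and $\tilde e_i^{\,n}$ is its $n$-th power for all $n\in\mathbb Z$; $\tilde\gamma(\tilde e_i^{\,1}(b))=\tilde\gamma(b)+\alpha_i^\vee$ for all $i$ and $b$; and for all $w\in W$, all $\mathbf i=(i_1,\dots,i_l),\ \mathbf i'=(i'_1,\dots,i'_l)\in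 R(w)$ and all $\lambda\in X_*(T)$, $$\tilde e_{i_1}^{\,\langle\alpha^{(1)},\lambda\rangle}\cdots\tilde e_{i_l}^{\,\langle\alpha^{(l)},\lambda\rangle}=\tilde e_{i'_1}^{\,\langle\alpha'^{(1)},\lambda\rangle}\cdots\tilde e_{i'_l}^{\,\langle\alpha'^{(l)},\lambda\rangle}$$ as bijections of $X_*(T')$, where $\alpha'^{(k)}$ are the roots attached to $\mathbf i'$. -/

import Mathlib

open scoped Topology

universe u v

noncomputable section

/-! ### Varieties and ind-varieties over `ℂ`

Classical language: a variety is a set with a topology and a notion of regular function. -/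

/-- A set with a topology and a notion of "the complex-valued function `f` is regular at the point
`x`", depending only on the germ of `f` at `x`.  A function is regular on an open set if it is
regular at each of its points. -/
structure FunSpace (X : Type*) where
  top : TopologicalSpace X
  RegAt : (X → ℂ) → X → Prop
  germ : ∀ (f g : X → ℂ) (x : X), (∀ᶠ y in @nhds X top x, f y = g y) → RegAt f x → RegAt g x

namespace FunSpace

variable {X Y : Type*}

/-- The space whose Zariski topology has the principal open sets `{a ≠ 0}`, `a ∈ A`, as a basis and
whose regular functions are locally quotients of elements of `A`. -/
def ofAlgebra (A : Subalgebra ℂ (X → ℂ)) : FunSpace X where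
  top := TopologicalSpace.generateFrom {U | ∃ a ∈ A, U = {x | a x ≠ 0}}
  RegAt f x := ∃ P ∈ A, ∃ Q ∈ A, Q x ≠ 0 ∧
    ∀ᶠ y in @nhds X (TopologicalSpace.generateFrom {U | ∃ a ∈ A, U = {x | a x ≠ 0}}) x,
      f y = P y / Q y
  germ := by
    rintro f g x h ⟨P, hP, Q, hQ, hx, hf⟩
    refine ⟨P, hP, Q, hQ, hx, ?_⟩
    filter_upwards [h, hf] with y h1 h2
    rw [← h1, h2]

/-- The structure induced on a subspace along an injection `j` (used for open subspaces and for
closed subvarieties). -/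
def induced (S : FunSpace X) (j : Y → X) : FunSpace Y where
  top := TopologicalSpace.induced j S.top
  RegAt f y := ∃ g : X → ℂ, S.RegAt g (j y) ∧
    ∀ᶠ z in @nhds Y (TopologicalSpace.induced j S.top) y, f z = g (j z)
  germ := by
    rintro f g x h ⟨k, hk, hf⟩
    refine ⟨k, hk, ?_⟩
    filter_upwards [h, hf] with y h1 h2
    rw [← h1, h2]

/-- The functions `∑ f_a(x) g_a(y)` with `f_a` regular on `U` and `g_a` regular on `V`. -/
def tensor (S : FunSpace X) (R : FunSpace Y) (U : Set X) (V : Set Y) :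
    Submodule ℂ (X × Y → ℂ) :=
  Submodule.span ℂ {h | ∃ (f : X → ℂ) (g : Y → ℂ), (∀ x ∈ U, S.RegAt f x) ∧
    (∀ y ∈ V, R.RegAt g y) ∧ h = fun p => f p.1 * g p.2}

/-- The Zariski topology of a product. -/
@[reducible] def prodTop (S : FunSpace X) (R : FunSpace Y) : TopologicalSpace (X × Y) :=
  TopologicalSpace.generateFrom {W | ∃ (U : Set X) (V : Set Y), IsOpen[S.top] U ∧ IsOpen[R.top] V ∧
    ∃ h ∈ tensor S R U V, W = {p | p.1 ∈ U ∧ p.2 ∈ V ∧ h p ≠ 0}}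

/-- The product of two spaces with functions: the usual product of varieties. -/
def prod (S : FunSpace X) (R : FunSpace Y) : FunSpace (X × Y) where
  top := prodTop S R
  RegAt F p := ∃ (U : Set X) (V : Set Y), IsOpen[S.top] U ∧ IsOpen[R.top] V ∧ p.1 ∈ U ∧ p.2 ∈ V ∧
    ∃ P ∈ tensor S R U V, ∃ Q ∈ tensor S R U V, Q p ≠ 0 ∧
      ∀ᶠ q in @nhds _ (prodTop S R) p, F q = P q / Q q
  germ := by
    rintro f g x h ⟨U, V, hU, hV, h1, h2, P, hP, Q, hQ, hx, hf⟩
    refine ⟨U, V, hU, hV, h1, h2, P, hP, Q, hQ, hx, ?_⟩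
    filter_upwards [h, hf] with y h1 h2
    rw [← h1, h2]

/-- An affine variety: its points are exactly the characters of a finitely generated algebra of
functions, which gives the topology and the regular functions. -/
def IsAffineVariety (S : FunSpace X) : Prop :=
  ∃ A : Subalgebra ℂ (X → ℂ), A.FG ∧ (∀ φ : A →ₐ[ℂ] ℂ, ∃! x : X, ∀ a : A, φ a = a.1 x) ∧
    S = ofAlgebra A

/-- A (not necessarily irreducible) variety: covered by finitely many affine open subsets, and
separated. -/
def IsVariety (S : FunSpace X) : Prop :=
  (∃ (n : ℕ) (U : Fin n → Set X), (∀ k, IsOpen[S.top] (U k)) ∧ (⋃ k, U k) = Set.univ ∧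
    ∀ k, (S.induced (Subtype.val : U k → X)).IsAffineVariety) ∧
  IsClosed[(S.prod S).top] {p : X × X | p.1 = p.2}

end FunSpace

/-- A set `carrier` exhausted by an increasing sequence of subsets, each of which is a space with
functions.  The `n`-th subset is given as an injection `emb n` of a type `level n`, and `incl n` is
the inclusion of the `n`-th subset into the next one. -/
structure IndSpace where
  carrier : Type u
  level : ℕ → Type u
  emb : ∀ n, level n → carrier
  emb_injective : ∀ n, Function.Injective (emb n)
  incl : ∀ n, level n → level (n + 1)
  emb_incl : ∀ n x, emb (n + 1) (incl n x) = emb n x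
  exhausts : ∀ x, ∃ n, x ∈ Set.range (emb n)
  sp : ∀ n, FunSpace (level n)

namespace IndSpace

/-- An ind-variety: `X₀ ⊆ X₁ ⊆ ⋯` are varieties and the inclusions are closed embeddings. -/
def IsIndVariety (X : IndSpace) : Prop :=
  (∀ n, (X.sp n).IsVariety) ∧
  ∀ n, IsClosed[(X.sp (n + 1)).top] (Set.range (X.incl n)) ∧
    X.sp n = (X.sp (n + 1)).induced (X.incl n)

/-- The Zariski topology: `U` is open iff its trace on each level is open. -/
@[reducible] def top (X : IndSpace) : TopologicalSpace X.carrier :=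
  ⨆ n, TopologicalSpace.coinduced (X.emb n) (X.sp n).top

/-- Open dense subsets. -/
def OpenDense (X : IndSpace) (W : Set X.carrier) : Prop :=
  IsOpen[X.top] W ∧ @Dense X.carrier X.top W

/-- A space with functions, with the constant filtration. -/
def const {X : Type u} (S : FunSpace X) : IndSpace.{u} where
  carrier := X
  level _ := X
  emb _ := id
  emb_injective _ := Function.injective_id
  incl _ := id
  emb_incl _ _ := rfl
  exhausts x := ⟨0, x, rfl⟩
  sp _ := S

lemma range_emb_mono (X : IndSpace) : Monotone fun n => Set.range (X.emb n) :=
  monotone_nat_of_le_succ fun n => by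
    rintro _ ⟨x, rfl⟩
    exact ⟨X.incl n x, X.emb_incl n x⟩

/-- The product, with the filtration `X_n × Y_n`. -/
def prod (X : IndSpace.{u}) (Y : IndSpace.{v}) : IndSpace.{max u v} where
  carrier := X.carrier × Y.carrier
  level n := X.level n × Y.level n
  emb n := Prod.map (X.emb n) (Y.emb n)
  emb_injective n := (X.emb_injective n).prodMap (Y.emb_injective n)
  incl n := Prod.map (X.incl n) (Y.incl n)
  emb_incl n p := Prod.ext (X.emb_incl n p.1) (Y.emb_incl n p.2)
  exhausts p := by
    obtain ⟨n, hn⟩ := X.exhausts p.1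
    obtain ⟨m, hm⟩ := Y.exhausts p.2
    obtain ⟨x, hx⟩ := X.range_emb_mono (le_max_left n m) hn
    obtain ⟨y, hy⟩ := Y.range_emb_mono (le_max_right n m) hm
    exact ⟨max n m, (x, y), Prod.ext hx hy⟩
  sp n := (X.sp n).prod (Y.sp n)

end IndSpace

/-- The restriction of `f : X → Y` to the open subset `U` of `X` is a morphism of ind-varieties:
each `U ∩ X_n` is mapped into some `Y_m`, where it is a morphism (continuous and pulling back regular
functions to regular functions). -/
def IsMorphismOn (X Y : IndSpace) (U : Set X.carrier) (f : X.carrier → Y.carrier) : Prop :=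
  ∀ n, ∃ m,
    (∀ x : X.level n, X.emb n x ∈ U → ∃ y : Y.level m, Y.emb m y = f (X.emb n x) ∧
      ∀ g : Y.carrier → ℂ, (Y.sp m).RegAt (fun z => g (Y.emb m z)) y →
        (X.sp n).RegAt (fun z => g (f (X.emb n z))) x) ∧
    ∀ O : Set Y.carrier, IsOpen[(Y.sp m).top] {y | Y.emb m y ∈ O} →
      IsOpen[(X.sp n).top] {x | X.emb n x ∈ U ∧ f (X.emb n x) ∈ O}

/-- A representative of a rational morphism: a morphism on an open dense subset `dom` (the values of
`map` outside `dom` are irrelevant). -/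
structure RatMor (X Y : IndSpace) where
  dom : Set X.carrier
  map : X.carrier → Y.carrier
  openDense : X.OpenDense dom
  morphism : IsMorphismOn X Y dom map

/-- The underlying partial function. -/
def RatMor.part {X Y : IndSpace} (f : RatMor X Y) : X.carrier →. Y.carrier :=
  fun x => ⟨x ∈ f.dom, fun _ => f.map x⟩

/-- Two partial functions (e.g. composites of rational morphisms) are both defined and equal on an
open dense subset, i.e. they are the same rational morphism. -/
def GenEq (X : IndSpace) {Z : Type*} (f g : X.carrier →. Z) : Prop :=
  ∃ W, X.OpenDense W ∧ ∀ x ∈ W, ∃ z, z ∈ f x ∧ z ∈ g x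

/-! ### Algebraic tori -/

/-- The Laurent polynomial functions on `(ℂˣ)^ι`. -/
def torusAlgebra (ι : Type) : Subalgebra ℂ ((ι → ℂˣ) → ℂ) :=
  Algebra.adjoin ℂ ((Set.range fun (i : ι) (t : ι → ℂˣ) => (t i : ℂ)) ∪
    (Set.range fun (i : ι) (t : ι → ℂˣ) => ((t i)⁻¹ : ℂ)))

/-- The algebraic torus `(ℂˣ)^ι`. -/
def torus (ι : Type) : IndSpace.{0} := IndSpace.const (FunSpace.ofAlgebra (torusAlgebra ι))

/-- The multiplicative group `ℂˣ`, with regular functions the Laurent polynomials in `c`. -/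
def Gm : IndSpace.{0} :=
  IndSpace.const (FunSpace.ofAlgebra (Algebra.adjoin ℂ
    {(fun c : ℂˣ => (c : ℂ)), (fun c : ℂˣ => (c⁻¹ : ℂ))}))

/-- The character `t ↦ ∏ t_k ^ μ_k` of a torus; the lattice of characters is `κ → ℤ`. -/
def torusChar {κ : Type} [Fintype κ] (μ : κ → ℤ) (t : κ → ℂˣ) : ℂˣ := ∏ k, t k ^ μ k

/-- The co-character `c ↦ (c ^ λ_k)_k` of a torus; the lattice of co-characters is `κ → ℤ`. -/
def torusCochar {κ : Type} (l : κ → ℤ) (c : ℂˣ) : κ → ℂˣ := fun k => c ^ l k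

/-- The pairing of a character with a co-character. -/
def charPairing {κ : Type} [Fintype κ] (μ l : κ → ℤ) : ℤ := ∑ k, μ k * l k

/-- The rational function `g` on the torus is the quotient `P / Q`. -/
def IsQuotient {ι : Type} (g : (ι → ℂˣ) →. ℂˣ) (P Q : MvPolynomial ι ℂ) : Prop :=
  ∃ W, (torus ι).OpenDense W ∧ ∀ t ∈ W, ∃ y ∈ g t,
    MvPolynomial.eval (fun i => (t i : ℂ)) Q ≠ 0 ∧
    (y : ℂ) = MvPolynomial.eval (fun i => (t i : ℂ)) P / MvPolynomial.eval (fun i => (t i : ℂ)) Q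

/-- A nonzero polynomial with nonnegative real coefficients. -/
def IsPositivePoly {ι : Type} (P : MvPolynomial ι ℂ) : Prop :=
  P ≠ 0 ∧ ∀ m, ∃ r : ℝ, 0 ≤ r ∧ P.coeff m = r

/-- A rational morphism `f : (ℂˣ)^ι → (ℂˣ)^κ` of tori is positive if, for each character `μ` of
the target, `μ ∘ f` is a quotient of two polynomials with positive coefficients. -/
def IsPositive {ι κ : Type} [Fintype κ] (f : (ι → ℂˣ) →. (κ → ℂˣ)) : Prop :=
  ∀ μ : κ → ℤ, ∃ P Q, IsPositivePoly P ∧ IsPositivePoly Q ∧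
    IsQuotient (fun t => (f t).map (torusChar μ)) P Q

/-! ### Formal loops and ultra-discretization -/

/-- The formal loops on `(ℂˣ)^ι`, i.e. its points over the field `ℂ((c))`. -/
abbrev Loop (ι : Type) : Type := ι → (LaurentSeries ℂ)ˣ

/-- The degree of a loop, an element of the lattice of co-characters: `v = - order` in each
coordinate. -/
def loopDeg {ι : Type} (φ : Loop ι) : ι → ℤ := fun i => -(φ i : LaurentSeries ℂ).order

/-- The leading coefficients of a loop. -/
def loopLead {ι : Type} (φ : Loop ι) : ι → ℂ := fun i => (φ i : LaurentSeries ℂ).leadingCoeff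

/-- The rational morphism `f` of tori is defined at the loop `φ` and maps it to the loop `ψ`:
in each coordinate, `f` is a quotient `P / Q` with `Q(φ) ≠ 0`, and `ψ = P(φ) / Q(φ)`. -/
def LoopMap {ι κ : Type} (f : (ι → ℂˣ) →. (κ → ℂˣ)) (φ : Loop ι) (ψ : Loop κ) : Prop :=
  ∀ k, ∃ P Q, IsQuotient (fun t => (f t).map fun y => y k) P Q ∧
    MvPolynomial.aeval (fun i => (φ i : LaurentSeries ℂ)) Q ≠ 0 ∧
    (ψ k : LaurentSeries ℂ) * MvPolynomial.aeval (fun i => (φ i : LaurentSeries ℂ)) Q =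
      MvPolynomial.aeval (fun i => (φ i : LaurentSeries ℂ)) P

/-- The map induced by `f` on formal loops maps the irreducible component `L_l` of loops of degree
`l` to the component `L_m`: it is defined on a nonempty Zariski open subset of `L_l` (cut out by a
polynomial condition on the leading coefficients), which it maps into `L_m`. -/
def MapsComponent {ι κ : Type} (f : (ι → ℂˣ) →. (κ → ℂˣ)) (l : ι → ℤ) (m : κ → ℤ) : Prop :=
  ∃ H : MvPolynomial ι ℂ, H ≠ 0 ∧ ∀ φ : Loop ι, loopDeg φ = l →
    MvPolynomial.eval (loopLead φ) H ≠ 0 → ∃ ψ : Loop κ, loopDeg ψ = m ∧ LoopMap f φ ψ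

/-- The ultra-discretization `deg(f) : X_*(T) → X_*(T')` of a rational morphism `f : T → T'` of
tori: the map induced on the irreducible components of the spaces of formal loops. -/
def ultraDeg {ι κ : Type} (f : (ι → ℂˣ) →. (κ → ℂˣ)) (l : ι → ℤ) : κ → ℤ :=
  Classical.epsilon (MapsComponent f l)

/-! ### Root data and Weyl groups -/

/-- A symmetrizable generalized Cartan matrix. -/
structure IsSymmetrizableGCM {I : Type} (A : Matrix I I ℤ) : Prop where
  diag : ∀ i, A i i = 2
  offDiag : ∀ i j, i ≠ j → A i j ≤ 0
  zero_iff : ∀ i j, A i j = 0 ↔ A j i = 0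
  symmetrizable : ∃ d : I → ℕ, (∀ i, 0 < d i) ∧ ∀ i j, d i * A i j = d j * A j i

/-- The simple reflection `s_i (α_j) = α_j - a_ij α_i` on the root lattice `⊕ ℤ α_j`; the Weyl
group `W` acts faithfully on this lattice. -/
def simpleRefl {I : Type} [Fintype I] [DecidableEq I] (A : Matrix I I ℤ) (i : I) :
    Module.End ℤ (I → ℤ) where
  toFun β := β - Pi.single i (∑ j, A i j * β j)
  map_add' β γ := by
    simp only [Pi.add_apply, mul_add, Finset.sum_add_distrib, Pi.single_add]
    abel
  map_smul' c β := by
    ext k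
    by_cases h : k = i
    · subst h
      simp [mul_sub, Finset.mul_sum, mul_left_comm]
    · simp [h]

/-- The element `s_{i_1} ⋯ s_{i_l}` of the Weyl group. -/
def wordProd {I : Type} [Fintype I] [DecidableEq I] (A : Matrix I I ℤ) (w : List I) :
    Module.End ℤ (I → ℤ) := (w.map (simpleRefl A)).prod

/-- `R(w)`: the reduced words of the element `w` of the Weyl group. It is empty if `w` is not in the
Weyl group. -/
def reducedWords {I : Type} [Fintype I] [DecidableEq I] (A : Matrix I I ℤ)
    (w : Module.End ℤ (I → ℤ)) : Set (List I) :=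
  {l | wordProd A l = w ∧ ∀ l', wordProd A l' = w → l.length ≤ l'.length}

/-- For a word `(i_1, …, i_l)`, the root `α^{(1)} = s_{i_l} ⋯ s_{i_2} (α_{i_1})`, in terms of
`i = i_1` and `w = (i_2, …, i_l)`. -/
def wordRoot {I : Type} [Fintype I] [DecidableEq I] (A : Matrix I I ℤ) (i : I) (w : List I) :
    I → ℤ := wordProd A w.reverse (Pi.single i 1)

/-- A torus `T = (ℂˣ)^κ` with simple co-roots `α_i^∨` and simple roots `α_i`, given as elements of
the lattices of co-characters and characters, such that `⟨α_i^∨, α_j⟩ = a_ij`. -/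
structure TorusDatum {I : Type} (A : Matrix I I ℤ) (κ : Type) [Fintype κ] where
  coroot : I → κ → ℤ
  root : I → κ → ℤ
  pairing : ∀ i j, charPairing (root j) (coroot i) = A i j

/-- The maximal torus `T = ∏ T_i` of the Kac-Moody group: `α_i^∨` is the `i`-th coordinate
embedding and `α_j ((t_i)_i) = ∏ t_i ^ a_ij`. -/
def kacMoodyTorus {I : Type} [Fintype I] [DecidableEq I] (A : Matrix I I ℤ) : TorusDatum A I where
  coroot i := Pi.single i 1
  root j := fun i => A i j
  pairing i j := by simp [charPairing, Pi.single_apply]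

/-- The element `∑ β_j α_j` of the root lattice, as a character of `T`. -/
def TorusDatum.char {I κ : Type} [Fintype I] [Fintype κ] {A : Matrix I I ℤ} (D : TorusDatum A κ)
    (β : I → ℤ) : κ → ℤ := fun k => ∑ j, β j * D.root j k

/-! ### Geometric crystals -/

section Crystals

variable {I κ : Type} [Fintype I] [DecidableEq I] [Fintype κ] {A : Matrix I I ℤ}

/-- For a word `i = (i_1, …, i_l)`, the composite
`e_i^t (x) = e_{i_1}^{α^{(1)}(t)} ⋯ e_{i_l}^{α^{(l)}(t)} (x)` as a partial function of `(t, x)`. -/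
def wordMap (D : TorusDatum A κ) (X : IndSpace.{u}) (e : I → RatMor (Gm.prod X) X) :
    List I → ((torus κ).prod X).carrier →. X.carrier
  | [], p => Part.some p.2
  | i :: w, p => (wordMap D X e w p).bind fun x =>
      (e i).part (torusChar (D.char (wordRoot A i w)) p.1, x)

/-- A geometric crystal: an ind-variety `X` with a rational morphism `γ : X → T` and rational
actions `e_i` of `ℂˣ` on `X`, such that `γ (e_i^c (x)) = α_i^∨(c) γ(x)` and such that the composites
`e_i` and `e_{i'}` agree for all reduced words `i, i'` of the same element of the Weyl group. -/
structure GeometricCrystal (D : TorusDatum A κ) where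
  X : IndSpace.{u}
  indVariety : X.IsIndVariety
  γ : RatMor X (torus κ)
  e : I → RatMor (Gm.prod X) X
  e_one : ∀ i, GenEq X (fun x => (e i).part ((1 : ℂˣ), x)) (fun x => Part.some x)
  e_mul : ∀ i, GenEq (Gm.prod (Gm.prod X))
    (fun p : ℂˣ × ℂˣ × X.carrier => ((e i).part (p.2.1, p.2.2)).bind fun x => (e i).part (p.1, x))
    (fun p : ℂˣ × ℂˣ × X.carrier => (e i).part ((p.1 * p.2.1 : ℂˣ), p.2.2))
  γ_e : ∀ i, GenEq (Gm.prod X) (Z := κ → ℂˣ)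
    (fun p : ℂˣ × X.carrier => ((e i).part p).bind γ.part)
    (fun p : ℂˣ × X.carrier => (γ.part p.2).map fun t : κ → ℂˣ => torusCochar (D.coroot i) p.1 * t)
  braid : ∀ w, ∀ l ∈ reducedWords A w, ∀ l' ∈ reducedWords A w,
    GenEq ((torus κ).prod X) (wordMap D X e l) (wordMap D X e l')

/-- A birational isomorphism `θ` of the torus `T' = (ℂˣ)^ι` with `X`. -/
structure TorusChart (ι : Type) (X : IndSpace.{u}) where
  θ : RatMor (torus ι) X
  inv : RatMor X (torus ι)
  left_inv : GenEq (torus ι) (fun t => (θ.part t).bind inv.part) (fun t => Part.some t)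
  right_inv : GenEq X (fun x => (inv.part x).bind θ.part) (fun x => Part.some x)

variable {D : TorusDatum A κ} {ι : Type}

/-- `γ ∘ θ : T' → T`. -/
def gammaTheta (χ : GeometricCrystal.{u} D) (Θ : TorusChart ι χ.X) : (ι → ℂˣ) →. (κ → ℂˣ) :=
  fun t => (Θ.θ.part t).bind χ.γ.part

/-- `e_{i,θ} (c, t) = θ⁻¹ (e_i^c (θ (t)))` on the torus `ℂˣ × T'`, whose coordinates are indexed by
`Option ι`, the coordinate `none` being `c`. -/
def eTheta (χ : GeometricCrystal.{u} D) (Θ : TorusChart ι χ.X) (i : I) :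
    (Option ι → ℂˣ) →. (ι → ℂˣ) :=
  fun s => ((Θ.θ.part fun k => s (some k)).bind fun x => (χ.e i).part (s none, x)).bind Θ.inv.part

/-- `θ` is a positive structure: `γ ∘ θ` and all `e_{i,θ}` are positive. -/
def IsPositiveStructure [Fintype ι] (χ : GeometricCrystal.{u} D) (Θ : TorusChart ι χ.X) : Prop :=
  IsPositive (gammaTheta χ Θ) ∧ ∀ i, IsPositive (eTheta χ Θ i)

/-- The ultra-discretized weight map `γ̃ : X_*(T') → X_*(T)`. -/
def udGamma (χ : GeometricCrystal.{u} D) (Θ : TorusChart ι χ.X) : (ι → ℤ) → (κ → ℤ) :=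
  ultraDeg (gammaTheta χ Θ)

/-- The ultra-discretized maps `ẽ_i : ℤ × X_*(T') → X_*(T')`. -/
def udE (χ : GeometricCrystal.{u} D) (Θ : TorusChart ι χ.X) (i : I) (n : ℤ) (b : ι → ℤ) : ι → ℤ :=
  ultraDeg (eTheta χ Θ i) fun k => k.elim n b

/-! ### Free W-crystals -/

/-- For bijections `E_i` of a set `B`, a word `(i_1, …, i_l)` and a co-character `l` of `T`, the
bijection `E_{i_1}^{⟨α^{(1)}, l⟩} ⋯ E_{i_l}^{⟨α^{(l)}, l⟩}` of `B`. -/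
def wordPerm (D : TorusDatum A κ) {B : Type*} (E : I → Equiv.Perm B) (l : κ → ℤ) :
    List I → Equiv.Perm B
  | [] => 1
  | i :: w => E i ^ charPairing (D.char (wordRoot A i w)) l * wordPerm D E l w

/-- `(B, wt, {e_i})`, with `wt : B → X_*(T)` and `e_i : ℤ × B → B`, is a free W-crystal:
`e_i (n, ·)` is the `n`-th power of a bijection `E_i` of `B` (freeness), `wt (E_i b) = wt b + α_i^∨`
(so that it is a pre-crystal), and for all reduced words of the same element of the Weyl group and
all co-characters of `T` the corresponding products of powers of the `E_i` agree. -/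
def IsFreeWCrystal (D : TorusDatum A κ) {B : Type*} (wt : B → κ → ℤ) (e : I → ℤ → B → B) : Prop :=
  ∃ E : I → Equiv.Perm B,
    (∀ i n b, e i n b = (E i ^ n) b) ∧
    (∀ i b, wt (E i b) = wt b + D.coroot i) ∧
    ∀ w, ∀ i ∈ reducedWords A w, ∀ i' ∈ reducedWords A w, ∀ l : κ → ℤ,
      wordPerm D E l i = wordPerm D E l i'

end Crystals

end

/-! A subtraction-free rational map of tori is defined at every point with positive real
coordinates. In logarithmic coordinates it becomes a continuous map `F` of real vector spaces, and
ultra-discretization is the large-scale limit of `F`: since a sum of positive monomials is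
comparable to its largest one, a sequence within bounded distance of the ray `s ↦ s l` is carried to
a sequence within bounded distance of the ray of `ultraDeg f l` (`IsPositive.exists_isLogMap`). Two
integral rays at bounded distance coincide (`Near.unique`). Hence an identity between composites of
the real maps, evaluated along integral rays, passes to the ultra-discretized maps, and no
functoriality statement for `ultraDeg` itself is needed.

It remains to prove the crystal identities for the real maps. The axioms hold on open dense sets of
ind-varieties. Pulled back to a torus through `θ`, such a set becomes a nonempty Zariski open set,
which contains the exponentials of a residual set of real vectors (`residual_of_zar`). Finitely many
generic conditions therefore hold together on a residual set; by Baire it is dense, and continuity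
extends the identity to all real vectors (`eq_of_residual`). Residual sets are used because they
pull back to residual sets under open continuous maps, in particular under surjective linear maps
and homeomorphisms.

Composites require that the inner map meets the domain of the outer one. For `e_i ∘ e_i` this is
dominance of `e_{i,θ}`, obtained by specializing the inner parameter to `1` (`residual_dominant`).
Once the group law (`act_add`, `act_zero`) makes each real `e_i` a flow, a word acts by a composite
of homeomorphisms, and the nonvanishing of the roots `α^{(k)}` as characters of `T` keeps its
parameters generic (`residual_wordMap`). The braid relations follow in `wordFlow_braid`, and
`near_wordPerm` carries them to the lattice. -/

noncomputable section

/-! ### Zariski open sets of a torus and its positive real points -/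

section ZariskiPoints

lemma IndSpace.const_top {X : Type u} (S : FunSpace X) : (IndSpace.const S).top = S.top := by
  show (⨆ _ : ℕ, TopologicalSpace.coinduced id S.top) = S.top
  rw [@coinduced_id _ S.top, @iSup_const _ ℕ _ S.top]

/-- Products of elements of `A` show that principal open sets are stable under finite intersection,
so they form a basis and not merely a subbasis. -/
lemma FunSpace.isOpen_ofAlgebra_iff {X : Type*} (A : Subalgebra ℂ (X → ℂ)) (U : Set X) :
    IsOpen[(FunSpace.ofAlgebra A).top] U ↔ ∀ x ∈ U, ∃ a ∈ A, a x ≠ 0 ∧ ∀ y, a y ≠ 0 → y ∈ U := by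
  let _ : TopologicalSpace X := (FunSpace.ofAlgebra A).top
  constructor
  · intro h
    induction h with
    | basic s hs =>
      obtain ⟨a, ha, rfl⟩ := hs
      exact fun x hx => ⟨a, ha, hx, fun y hy => hy⟩
    | univ => exact fun x _ => ⟨1, one_mem _, one_ne_zero, fun y _ => trivial⟩
    | inter s t _ _ hs ht =>
      rintro x ⟨h1, h2⟩
      obtain ⟨a, ha, hax, has⟩ := hs x h1
      obtain ⟨b, hb, hbx, hbt⟩ := ht x h2
      exact ⟨a * b, mul_mem ha hb, mul_ne_zero hax hbx, fun y hy =>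
        ⟨has y (left_ne_zero_of_mul hy), hbt y (right_ne_zero_of_mul hy)⟩⟩
    | sUnion S _ hS =>
      rintro x ⟨s, hs, hx⟩
      obtain ⟨a, ha, hax, has⟩ := hS s hs x hx
      exact ⟨a, ha, hax, fun y hy => ⟨s, hs, has y hy⟩⟩
  · intro h
    rw [isOpen_iff_forall_mem_open]
    intro x hx
    obtain ⟨a, ha, hax, hU⟩ := h x hx
    exact ⟨{y | a y ≠ 0}, hU, TopologicalSpace.isOpen_generateFrom_of_mem ⟨a, ha, rfl⟩, hax⟩

/-- The Zariski topology of the torus `(ℂˣ)^σ`. -/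
abbrev zar (σ : Type) : TopologicalSpace (σ → ℂˣ) := (FunSpace.ofAlgebra (torusAlgebra σ)).top

variable {σ : Type}

lemma torus_top : (torus σ).top = zar σ := IndSpace.const_top _

/-- Clearing denominators reduces nonvanishing of a Laurent polynomial on the torus to nonvanishing
of an ordinary polynomial. -/
lemma torusAlgebra_clear {a : (σ → ℂˣ) → ℂ} (ha : a ∈ torusAlgebra σ) :
    ∃ p q : MvPolynomial σ ℂ, (∀ t : σ → ℂˣ, MvPolynomial.eval (fun i => (t i : ℂ)) q ≠ 0) ∧
      ∀ t : σ → ℂˣ, a t * MvPolynomial.eval (fun i => (t i : ℂ)) q =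
        MvPolynomial.eval (fun i => (t i : ℂ)) p := by
  induction ha using Algebra.adjoin_induction with
  | mem x hx =>
    rcases hx with ⟨i, rfl⟩ | ⟨i, rfl⟩
    · exact ⟨MvPolynomial.X i, 1, by simp, by simp⟩
    · exact ⟨1, MvPolynomial.X i, by simp, by simp⟩
  | algebraMap r => exact ⟨MvPolynomial.C r, 1, by simp, by simp⟩
  | add x y _ _ hx hy =>
    obtain ⟨p, q, hq, h⟩ := hx
    obtain ⟨p', q', hq', h'⟩ := hy
    refine ⟨p * q' + p' * q, q * q', fun t => by simp [hq t, hq' t], fun t => ?_⟩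
    simp only [map_mul, map_add, ← h t, ← h' t, Pi.add_apply]
    ring
  | mul x y _ _ hx hy =>
    obtain ⟨p, q, hq, h⟩ := hx
    obtain ⟨p', q', hq', h'⟩ := hy
    refine ⟨p * p', q * q', fun t => by simp [hq t, hq' t], fun t => ?_⟩
    simp only [map_mul, ← h t, ← h' t, Pi.mul_apply]
    ring

lemma eval_mem_subalgebra {T : Type} {A : Subalgebra ℂ (T → ℂ)} {F : T → σ → ℂ}
    (hF : ∀ k, (fun t => F t k) ∈ A) (p : MvPolynomial σ ℂ) :
    (fun t => MvPolynomial.eval (F t) p) ∈ A := by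
  induction p using MvPolynomial.induction_on with
  | C a =>
    simp only [MvPolynomial.eval_C]
    exact A.algebraMap_mem a
  | add p q hp hq =>
    simp only [map_add]
    exact add_mem hp hq
  | mul_X p i hp =>
    simp only [map_mul, MvPolynomial.eval_X]
    exact mul_mem hp (hF i)

/-- The positive real number `exp r`, as an element of `ℂˣ`. -/
def expUnit (r : ℝ) : ℂˣ := Units.mk0 (Real.exp r : ℂ) (by exact_mod_cast Real.exp_ne_zero r)

/-- The point of the torus with positive real coordinates `exp (u k)`. -/
def expPoint (u : σ → ℝ) : σ → ℂˣ := fun k => expUnit (u k)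

@[simp] lemma expUnit_val (r : ℝ) : (expUnit r : ℂ) = (Real.exp r : ℂ) := rfl

lemma expUnit_injective : Function.Injective expUnit := fun r s h => by
  have := congrArg (Units.val) h
  simp only [expUnit_val] at this
  exact Real.exp_injective (by exact_mod_cast this)

lemma expPoint_injective : Function.Injective (expPoint : (σ → ℝ) → σ → ℂˣ) := fun _ _ h =>
  funext fun k => expUnit_injective (congrFun h k)

lemma expUnit_add (r s : ℝ) : expUnit (r + s) = expUnit r * expUnit s := by
  ext; simp [Complex.exp_add]

lemma expUnit_zpow (r : ℝ) (n : ℤ) : expUnit r ^ n = expUnit (n * r) := by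
  ext; simp [Complex.exp_int_mul]

lemma expUnit_sum {κ : Type} (s : Finset κ) (f : κ → ℝ) :
    expUnit (∑ k ∈ s, f k) = ∏ k ∈ s, expUnit (f k) := by
  ext; simp [Complex.exp_sum]

lemma torusChar_expPoint {κ : Type} [Fintype κ] (μ : κ → ℤ) (t : κ → ℝ) :
    torusChar μ (expPoint t) = expUnit (∑ k, μ k * t k) := by
  simp [torusChar, expPoint, expUnit_zpow, expUnit_sum]

lemma torusCochar_expUnit {κ : Type} (l : κ → ℤ) (r : ℝ) :
    torusCochar l (expUnit r) = expPoint fun k => l k * r := by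
  funext k
  simp [torusCochar, expPoint, expUnit_zpow]

/-- A polynomial that vanishes on a product of infinite sets is zero. The exponential of a small
real box is such a product, so the nonvanishing locus is dense as well as open. -/
lemma residual_eval_ne_zero [Fintype σ] {p : MvPolynomial σ ℂ} (hp : p ≠ 0) :
    ∀ᶠ u in residual (σ → ℝ), MvPolynomial.eval (fun i => (expPoint u i : ℂ)) p ≠ 0 := by
  have hc : Continuous fun u : σ → ℝ => MvPolynomial.eval (fun i => (expPoint u i : ℂ)) p := by
    apply (MvPolynomial.continuous_eval p).comp
    simp only [expPoint, expUnit_val]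
    fun_prop
  refine residual_of_dense_open (isOpen_ne_fun hc continuous_const) ?_
  rw [dense_iff_inter_open]
  rintro V hV ⟨v, hv⟩
  obtain ⟨ε, hε, hball⟩ := Metric.isOpen_iff.1 hV v hv
  by_contra hne
  rw [Set.not_nonempty_iff_eq_empty] at hne
  apply hp
  refine MvPolynomial.funext_set
    (fun i => (fun r : ℝ => (Real.exp r : ℂ)) '' Set.Ioo (v i - ε) (v i + ε)) ?_ ?_
  · intro i
    refine (Set.Ioo_infinite (by linarith)).image fun _ _ _ _ h => ?_
    exact Real.exp_injective (by exact_mod_cast h)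
  · intro x hx
    choose u hu hux using fun i => hx i trivial
    have huV : u ∈ V := by
      apply hball
      rw [Metric.mem_ball, dist_pi_lt_iff hε]
      intro i
      rw [Real.dist_eq, abs_lt]
      constructor <;> linarith [(hu i).1, (hu i).2]
    have : u ∉ {u : σ → ℝ | MvPolynomial.eval (fun i => (expPoint u i : ℂ)) p ≠ 0} := fun h => by
      have : u ∈ (∅ : Set (σ → ℝ)) := hne ▸ ⟨huV, h⟩
      exact this
    have h2 : MvPolynomial.eval (fun i => (expPoint u i : ℂ)) p = 0 := by simpa using this
    have h3 : (fun i => (expPoint u i : ℂ)) = x := funext hux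
    rw [← h3, h2, map_zero]

/-- This is the bridge from algebraic to real genericity: positive real points are Zariski dense,
and Zariski-generic conditions become conditions that can be combined in the residual filter. -/
lemma residual_of_zar [Fintype σ] {U : Set (σ → ℂˣ)} (hU : IsOpen[zar σ] U) (hne : U.Nonempty) :
    ∀ᶠ u in residual (σ → ℝ), expPoint u ∈ U := by
  obtain ⟨x, hx⟩ := hne
  obtain ⟨a, ha, hax, haU⟩ := (FunSpace.isOpen_ofAlgebra_iff _ _).1 hU x hx
  obtain ⟨p, q, hq, h⟩ := torusAlgebra_clear ha
  have hp : p ≠ 0 := by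
    rintro rfl
    have := h x
    simp [hax, hq x] at this
  filter_upwards [residual_eval_ne_zero hp] with u hu
  refine haU _ fun h0 => hu ?_
  rw [← h, h0, zero_mul]

lemma residual_exists {X : Type*} [TopologicalSpace X] [BaireSpace X] [Nonempty X] {P : X → Prop}
    (h : ∀ᶠ x in residual X, P x) : ∃ x, P x :=
  (dense_of_mem_residual h).nonempty

lemma zar_inter_nonempty [Fintype σ] {U V : Set (σ → ℂˣ)} (hU : IsOpen[zar σ] U)
    (hV : IsOpen[zar σ] V) (hU' : U.Nonempty) (hV' : V.Nonempty) : (U ∩ V).Nonempty := by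
  obtain ⟨u, h1, h2⟩ := residual_exists ((residual_of_zar hU hU').and (residual_of_zar hV hV'))
  exact ⟨_, h1, h2⟩

lemma IndSpace.OpenDense.isOpen_zar {W : Set (σ → ℂˣ)} (h : (torus σ).OpenDense W) :
    IsOpen[zar σ] W := torus_top (σ := σ) ▸ h.1

lemma IndSpace.OpenDense.nonempty {X : IndSpace.{u}} {W : Set X.carrier} (h : X.OpenDense W)
    [Nonempty X.carrier] : W.Nonempty :=
  @Dense.nonempty _ X.top _ _ h.2

lemma IndSpace.OpenDense.torus_nonempty {W : Set (σ → ℂˣ)} (h : (torus σ).OpenDense W) :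
    W.Nonempty :=
  haveI : Nonempty (torus σ).carrier := ⟨(1 : σ → ℂˣ)⟩
  h.nonempty

lemma IndSpace.OpenDense.residual [Fintype σ] {W : Set (σ → ℂˣ)} (h : (torus σ).OpenDense W) :
    ∀ᶠ u in _root_.residual (σ → ℝ), expPoint u ∈ W :=
  residual_of_zar h.isOpen_zar h.torus_nonempty

end ZariskiPoints

lemma mem_nhds_of_isOpen {X : Type*} {t : TopologicalSpace X} {U : Set X} (hU : IsOpen[t] U) {x : X}
    (hx : x ∈ U) : U ∈ @nhds X t x :=
  hU.mem_nhds hx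

lemma exists_isOpen_of_eventually {X : Type*} {t : TopologicalSpace X} {x : X} {p : X → Prop}
    (h : ∀ᶠ y in @nhds X t x, p y) : ∃ U, (∀ y ∈ U, p y) ∧ IsOpen[t] U ∧ x ∈ U :=
  eventually_nhds_iff.1 h

lemma isOpen_inter_of {X : Type*} {t : TopologicalSpace X} {U V : Set X} (hU : IsOpen[t] U)
    (hV : IsOpen[t] V) : IsOpen[t] (U ∩ V) :=
  hU.inter hV

/-! ### Arithmetic of regular functions -/

section RegularFunctions

variable {T : Type} {A : Subalgebra ℂ (T → ℂ)}

lemma FunSpace.regAt_of_mem {f : T → ℂ} (hf : f ∈ A) (x : T) :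
    (FunSpace.ofAlgebra A).RegAt f x :=
  ⟨f, hf, 1, one_mem _, one_ne_zero, Filter.Eventually.of_forall fun y => by simp⟩

lemma FunSpace.regAt_const (c : ℂ) (x : T) : (FunSpace.ofAlgebra A).RegAt (fun _ => c) x :=
  FunSpace.regAt_of_mem (A.algebraMap_mem c) x

lemma FunSpace.eventually_ne_of_mem {Q : T → ℂ} (hQ : Q ∈ A) {x : T} (hx : Q x ≠ 0) :
    ∀ᶠ y in @nhds T (FunSpace.ofAlgebra A).top x, Q y ≠ 0 :=
  mem_nhds_of_isOpen (t := (FunSpace.ofAlgebra A).top) (U := {y | Q y ≠ 0})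
    (TopologicalSpace.isOpen_generateFrom_of_mem
      (g := {U | ∃ a ∈ A, U = {x | a x ≠ 0}}) ⟨Q, hQ, rfl⟩) hx

lemma FunSpace.RegAt.add {f g : T → ℂ} {x : T} (hf : (FunSpace.ofAlgebra A).RegAt f x)
    (hg : (FunSpace.ofAlgebra A).RegAt g x) :
    (FunSpace.ofAlgebra A).RegAt (fun y => f y + g y) x := by
  obtain ⟨P, hP, Q, hQ, hx, hf⟩ := hf
  obtain ⟨P', hP', Q', hQ', hx', hg⟩ := hg
  refine ⟨P * Q' + Q * P', add_mem (mul_mem hP hQ') (mul_mem hQ hP'), Q * Q', mul_mem hQ hQ',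
    mul_ne_zero hx hx', ?_⟩
  filter_upwards [hf, hg, eventually_ne_of_mem hQ hx, eventually_ne_of_mem hQ' hx']
    with y h1 h2 h3 h4
  rw [h1, h2, div_add_div _ _ h3 h4]
  rfl

lemma FunSpace.RegAt.mul {f g : T → ℂ} {x : T} (hf : (FunSpace.ofAlgebra A).RegAt f x)
    (hg : (FunSpace.ofAlgebra A).RegAt g x) :
    (FunSpace.ofAlgebra A).RegAt (fun y => f y * g y) x := by
  obtain ⟨P, hP, Q, hQ, hx, hf⟩ := hf
  obtain ⟨P', hP', Q', hQ', hx', hg⟩ := hg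
  refine ⟨P * P', mul_mem hP hP', Q * Q', mul_mem hQ hQ', mul_ne_zero hx hx', ?_⟩
  filter_upwards [hf, hg] with y h1 h2
  rw [h1, h2, div_mul_div_comm]
  rfl

lemma FunSpace.RegAt.inv {f : T → ℂ} {x : T} (hf : (FunSpace.ofAlgebra A).RegAt f x)
    (h0 : f x ≠ 0) : (FunSpace.ofAlgebra A).RegAt (fun y => (f y)⁻¹) x := by
  obtain ⟨P, hP, Q, hQ, hx, hf⟩ := hf
  refine ⟨Q, hQ, P, hP, fun hPx => h0 ?_, ?_⟩
  · rw [@Filter.Eventually.self_of_nhds T (FunSpace.ofAlgebra A).top _ _ hf, hPx, zero_div]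
  · filter_upwards [hf] with y h1
    rw [h1, inv_div]

lemma FunSpace.RegAt.eventually_ne {f : T → ℂ} {x : T} (hf : (FunSpace.ofAlgebra A).RegAt f x)
    (h0 : f x ≠ 0) : ∀ᶠ y in @nhds T (FunSpace.ofAlgebra A).top x, f y ≠ 0 := by
  obtain ⟨P, hP, Q, hQ, hx, hf⟩ := hf
  have hPx : P x ≠ 0 := fun hPx => h0 <| by
    rw [@Filter.Eventually.self_of_nhds T (FunSpace.ofAlgebra A).top _ _ hf, hPx, zero_div]
  filter_upwards [hf, eventually_ne_of_mem hQ hx, eventually_ne_of_mem hP hPx] with y h1 h2 h3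
  rw [h1]
  exact div_ne_zero h3 h2

end RegularFunctions

/-! ### Morphisms of ind-varieties and maps into products -/

section Morphisms

lemma IndSpace.isOpen_top_iff (X : IndSpace.{u}) (O : Set X.carrier) :
    IsOpen[X.top] O ↔ ∀ n, IsOpen[(X.sp n).top] (X.emb n ⁻¹' O) := by
  rw [isOpen_iSup_iff]
  exact forall_congr' fun n => @isOpen_coinduced _ _ (X.sp n).top _ _

lemma IsMorphismOn.comp {X : IndSpace.{u}} {Y : IndSpace.{v}} {Z : IndSpace}
    {U : Set X.carrier} {V : Set Y.carrier} {f : X.carrier → Y.carrier}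
    {g : Y.carrier → Z.carrier} (hf : IsMorphismOn X Y U f) (hg : IsMorphismOn Y Z V g) :
    IsMorphismOn X Z (U ∩ f ⁻¹' V) (fun x => g (f x)) := by
  intro n
  obtain ⟨m, hf1, hf2⟩ := hf n
  obtain ⟨k, hg1, hg2⟩ := hg m
  refine ⟨k, ?_, ?_⟩
  · rintro x ⟨hxU, hxV⟩
    obtain ⟨y, hy, hfy⟩ := hf1 x hxU
    obtain ⟨z, hz, hgz⟩ := hg1 y (by rw [hy]; exact hxV)
    refine ⟨z, by rw [hz, hy], fun h hh => hfy (fun y => h (g y)) (hgz h hh)⟩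
  · intro O hO
    have := hf2 {y | y ∈ V ∧ g y ∈ O} (hg2 O hO)
    convert this using 1
    ext x
    simp [and_assoc]

lemma IsMorphismOn.mono {X : IndSpace.{u}} {Y : IndSpace.{v}}
    {U U' : Set X.carrier} {f : X.carrier → Y.carrier}
    (hf : IsMorphismOn X Y U f) (hU : U' ⊆ U) (ho : IsOpen[X.top] U') :
    IsMorphismOn X Y U' f := by
  intro n
  obtain ⟨m, hf1, hf2⟩ := hf n
  refine ⟨m, fun x hx => hf1 x (hU hx), fun O hO => ?_⟩
  have := isOpen_inter_of ((X.isOpen_top_iff U').1 ho n) (hf2 O hO)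
  convert this using 1
  ext x
  simp only [Set.mem_ofPred_eq, Set.mem_inter_iff, Set.mem_preimage]
  exact ⟨fun h => ⟨h.1, hU h.1, h.2⟩, fun h => ⟨h.1, h.2.2⟩⟩

lemma IsMorphismOn.isOpen_preimage {X : IndSpace.{u}} {Y : IndSpace.{v}}
    {U : Set X.carrier} {f : X.carrier → Y.carrier}
    (hf : IsMorphismOn X Y U f) {O : Set Y.carrier} (hO : IsOpen[Y.top] O) :
    IsOpen[X.top] (U ∩ f ⁻¹' O) := by
  rw [IndSpace.isOpen_top_iff]
  intro n
  obtain ⟨m, -, hf2⟩ := hf n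
  exact hf2 O ((Y.isOpen_top_iff O).1 hO m)

lemma isMorphismOn_of_comp_mem {T T' : Type} {A : Subalgebra ℂ (T → ℂ)}
    {B : Subalgebra ℂ (T' → ℂ)} {φ : T → T'} (h : ∀ b ∈ B, (fun x => b (φ x)) ∈ A) :
    IsMorphismOn (IndSpace.const (FunSpace.ofAlgebra A)) (IndSpace.const (FunSpace.ofAlgebra B))
      Set.univ φ := by
  have hpre : ∀ O : Set T', IsOpen[(FunSpace.ofAlgebra B).top] O →
      IsOpen[(FunSpace.ofAlgebra A).top] (φ ⁻¹' O) := by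
    intro O hO
    rw [FunSpace.isOpen_ofAlgebra_iff] at hO ⊢
    intro x hx
    obtain ⟨b, hb, hbx, hbO⟩ := hO (φ x) hx
    exact ⟨_, h b hb, hbx, fun y hy => hbO _ hy⟩
  intro n
  refine ⟨0, fun x _ => ⟨φ x, rfl, fun g hg => ?_⟩, fun O hO => ?_⟩
  · obtain ⟨P, hP, Q, hQ, hx, hf⟩ := hg
    refine ⟨_, h P hP, _, h Q hQ, hx, ?_⟩
    have hf' : ∀ᶠ y in @nhds T' (FunSpace.ofAlgebra B).top (φ x), g y = P y / Q y := hf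
    obtain ⟨t, ht, hto, hxt⟩ := exists_isOpen_of_eventually hf'
    filter_upwards [mem_nhds_of_isOpen (hpre t hto) hxt] with y hy
    exact ht _ hy
  · have hset : {x : T | x ∈ Set.univ ∧ φ x ∈ O} = φ ⁻¹' O := by
      ext x
      exact ⟨fun h => h.2, fun h => ⟨trivial, h⟩⟩
    exact hset ▸ hpre O hO

section Pair

variable {T Y : Type} {A : Subalgebra ℂ (T → ℂ)} {SY : FunSpace Y} {Z : IndSpace.{u}}
  {U : Set T} {f : T → Y} {g : T → Z.carrier}

/-- The pullback of `∑ f_a ⊗ g_a` is a sum of products of regular functions. As `g` takes values in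
the whole ind-variety while `h` lives on the level `m`, the statement concerns any extension `H` of
`h`; injectivity of `emb m` supplies extensions of the summands. -/
lemma regAt_pair_of_mem_tensor (hU : IsOpen[(FunSpace.ofAlgebra A).top] U) {m : ℕ}
    (hf : ∀ x ∈ U, ∀ r : Y → ℂ, SY.RegAt r (f x) → (FunSpace.ofAlgebra A).RegAt (fun z => r (f z)) x)
    (hg : ∀ x ∈ U, ∃ y : Z.level m, Z.emb m y = g x ∧ ∀ r : Z.carrier → ℂ,
      (Z.sp m).RegAt (fun z => r (Z.emb m z)) y → (FunSpace.ofAlgebra A).RegAt (fun z => r (g z)) x)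
    {O₁ : Set Y} {O₂ : Set (Z.level m)} {h : Y × Z.level m → ℂ}
    (hh : h ∈ FunSpace.tensor SY (Z.sp m) O₁ O₂) (H : Y × Z.carrier → ℂ)
    (hH : ∀ y z, H (y, Z.emb m z) = h (y, z)) {x : T} (hx : x ∈ U) (hx₁ : f x ∈ O₁)
    {z : Z.level m} (hz : Z.emb m z = g x) (hz₂ : z ∈ O₂) :
    (FunSpace.ofAlgebra A).RegAt (fun t => H (f t, g t)) x := by
  have hev : ∀ᶠ t in @nhds T (FunSpace.ofAlgebra A).top x, t ∈ U :=
    mem_nhds_of_isOpen hU hx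
  have hext : ∀ h : Y × Z.level m → ℂ, ∃ H : Y × Z.carrier → ℂ,
      ∀ y z, H (y, Z.emb m z) = h (y, z) := fun h =>
    ⟨Function.extend (Prod.map id (Z.emb m)) h 0, fun y z =>
      (Function.injective_id.prodMap (Z.emb_injective m)).extend_apply h 0 (y, z)⟩
  induction hh using Submodule.span_induction generalizing H with
  | mem h hh =>
    obtain ⟨r, s, hr, hs, rfl⟩ := hh
    have h1 := hf x hx r (hr _ hx₁)
    obtain ⟨z', hz', hreg⟩ := hg x hx
    obtain rfl : z' = z := Z.emb_injective m (hz'.trans hz.symm)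
    have hs' := fun w => (Z.emb_injective m).extend_apply s 0 w
    have h2 := hreg (Function.extend (Z.emb m) s 0) (by simpa only [hs'] using hs _ hz₂)
    refine (FunSpace.ofAlgebra A).germ _ _ x ?_ (FunSpace.RegAt.mul h1 h2)
    filter_upwards [hev] with t ht
    obtain ⟨w, hw, -⟩ := hg t ht
    rw [← hw, hH, hs']
  | zero =>
    refine (FunSpace.ofAlgebra A).germ _ _ x ?_ (FunSpace.regAt_const 0 x)
    filter_upwards [hev] with t ht
    obtain ⟨w, hw, -⟩ := hg t ht
    rw [← hw, hH]
    rfl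
  | add a b _ _ ha hb =>
    obtain ⟨Ha, hHa⟩ := hext a
    obtain ⟨Hb, hHb⟩ := hext b
    refine (FunSpace.ofAlgebra A).germ _ _ x ?_ (FunSpace.RegAt.add (ha Ha hHa) (hb Hb hHb))
    filter_upwards [hev] with t ht
    obtain ⟨w, hw, -⟩ := hg t ht
    rw [← hw, hH, hHa, hHb]
    rfl
  | smul c a _ ha =>
    obtain ⟨Ha, hHa⟩ := hext a
    refine (FunSpace.ofAlgebra A).germ _ _ x ?_
      (FunSpace.RegAt.mul (FunSpace.regAt_const c x) (ha Ha hHa))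
    filter_upwards [hev] with t ht
    obtain ⟨w, hw, -⟩ := hg t ht
    rw [← hw, hH, hHa]
    rfl

/-- Half of the universal property of the product. It makes `(c, t) ↦ (c, θ t)` a morphism, so that
open dense sets in products with `X` can be pulled back to tori. -/
lemma IsMorphismOn.pair (hU : IsOpen[(FunSpace.ofAlgebra A).top] U)
    (hf : IsMorphismOn (IndSpace.const (FunSpace.ofAlgebra A)) (IndSpace.const SY) U f)
    (hg : IsMorphismOn (IndSpace.const (FunSpace.ofAlgebra A)) Z U g) :
    IsMorphismOn (IndSpace.const (FunSpace.ofAlgebra A)) ((IndSpace.const SY).prod Z) U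
      (fun x => (f x, g x)) := by
  intro n
  obtain ⟨_, hf1, hf2⟩ := hf n
  obtain ⟨m, hg1, hg2⟩ := hg n
  have hf1' : ∀ x ∈ U, ∀ r : Y → ℂ, SY.RegAt r (f x) →
      (FunSpace.ofAlgebra A).RegAt (fun z => r (f z)) x := by
    intro x hx r hr
    obtain ⟨y, hy, h⟩ := hf1 x hx
    obtain rfl : y = f x := hy
    exact h r hr
  have hg1' : ∀ x ∈ U, ∃ y : Z.level m, Z.emb m y = g x ∧ ∀ r : Z.carrier → ℂ,
      (Z.sp m).RegAt (fun z => r (Z.emb m z)) y →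
      (FunSpace.ofAlgebra A).RegAt (fun z => r (g z)) x := hg1
  have hext : ∀ h : Y × Z.level m → ℂ, ∃ H : Y × Z.carrier → ℂ,
      ∀ y z, H (y, Z.emb m z) = h (y, z) := fun h =>
    ⟨Function.extend (Prod.map id (Z.emb m)) h 0, fun y z =>
      (Function.injective_id.prodMap (Z.emb_injective m)).extend_apply h 0 (y, z)⟩
  -- Continuity is checked on the generating open sets: each is a box cut down by `h ≠ 0`, and `h`
  -- pulls back to a regular function, whose nonvanishing is an open condition.
  have hpre : ∀ W : Set (Y × Z.level m), IsOpen[FunSpace.prodTop SY (Z.sp m)] W →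
      IsOpen[(FunSpace.ofAlgebra A).top] {x | x ∈ U ∧ ∃ z, Z.emb m z = g x ∧ (f x, z) ∈ W} := by
    let _ : TopologicalSpace T := (FunSpace.ofAlgebra A).top
    intro W hW
    induction hW with
    | basic W hW =>
      obtain ⟨O₁, O₂, hO₁, hO₂, h, hh, rfl⟩ := hW
      rw [isOpen_iff_mem_nhds]
      rintro x ⟨hx, z, hz, hx₁, hz₂, hne⟩
      obtain ⟨H, hH⟩ := hext h
      have hreg := regAt_pair_of_mem_tensor hU hf1' hg1' hh H hH hx hx₁ hz hz₂
      have hev1 := FunSpace.RegAt.eventually_ne hreg (by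
        show H (f x, g x) ≠ 0
        rw [← hz, hH]; exact hne)
      have hev2 : {x | x ∈ U ∧ f x ∈ O₁} ∈ 𝓝 x := mem_nhds_of_isOpen (hf2 O₁ hO₁) ⟨hx, hx₁⟩
      have hev3 : {x | x ∈ U ∧ g x ∈ Z.emb m '' O₂} ∈ 𝓝 x := by
        have hset : {y | Z.emb m y ∈ Z.emb m '' O₂} = O₂ := by
          ext y
          exact (Z.emb_injective m).mem_set_image
        exact mem_nhds_of_isOpen (hg2 (Z.emb m '' O₂) (hset.symm ▸ hO₂)) ⟨hx, z, hz₂, hz⟩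
      filter_upwards [hev1, hev2, hev3] with t h1 h2 h3
      obtain ⟨w, hw, hwt⟩ := h3.2
      refine ⟨h2.1, w, hwt, h2.2, hw, ?_⟩
      rw [← hwt, hH] at h1
      exact h1
    | univ =>
      convert hU using 1
      ext x
      refine ⟨fun h => h.1, fun h => ⟨h, ?_⟩⟩
      obtain ⟨z, hz, -⟩ := hg1' x h
      exact ⟨z, hz, trivial⟩
    | inter s t _ _ hs ht =>
      convert hs.inter ht using 1
      ext x
      constructor
      · rintro ⟨hx, z, hz, h1, h2⟩
        exact ⟨⟨hx, z, hz, h1⟩, hx, z, hz, h2⟩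
      · rintro ⟨⟨hx, z, hz, h1⟩, -, z', hz', h2⟩
        obtain rfl : z' = z := Z.emb_injective m (hz'.trans hz.symm)
        exact ⟨hx, _, hz, h1, h2⟩
    | sUnion S _ hS =>
      convert isOpen_biUnion hS using 1
      ext x
      simp only [Set.mem_ofPred_eq, Set.mem_sUnion, Set.mem_iUnion]
      constructor
      · rintro ⟨hx, z, hz, s, hs, h⟩
        exact ⟨s, hs, hx, z, hz, h⟩
      · rintro ⟨s, hs, hx, z, hz, h⟩
        exact ⟨hx, z, hz, s, hs, h⟩
  refine ⟨m, fun x hx => ?_, fun O hO => ?_⟩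
  · have hxU : x ∈ U := hx
    obtain ⟨z, hz, -⟩ := hg1' x hxU
    refine ⟨(f x, z), Prod.ext rfl hz, fun G hG => ?_⟩
    obtain ⟨O₁, O₂, hO₁, hO₂, hx₁, hz₂, P, hP, Q, hQ, hne, hev⟩ := hG
    obtain ⟨HP, hHP⟩ := hext P
    obtain ⟨HQ, hHQ⟩ := hext Q
    have hPreg := regAt_pair_of_mem_tensor hU hf1' hg1' hP HP hHP hxU hx₁ hz hz₂
    have hQreg := regAt_pair_of_mem_tensor hU hf1' hg1' hQ HQ hHQ hxU hx₁ hz hz₂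
    have hinv := FunSpace.RegAt.inv hQreg (by
      show HQ (f x, g x) ≠ 0
      rw [← hz, hHQ]; exact hne)
    refine (FunSpace.ofAlgebra A).germ _ _ x ?_ (FunSpace.RegAt.mul hPreg hinv)
    obtain ⟨W, hW, hWo, hxW⟩ := exists_isOpen_of_eventually hev
    filter_upwards [mem_nhds_of_isOpen (hpre W hWo) ⟨hxU, z, hz, hxW⟩] with t ht
    obtain ⟨-, w, hw, hwW⟩ := ht
    have h1 : G (f t, Z.emb m w) = P (f t, w) / Q (f t, w) := hW _ hwW
    show HP (f t, g t) * (HQ (f t, g t))⁻¹ = G (f t, g t)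
    rw [← hw, hHP, hHQ, ← div_eq_mul_inv]
    exact h1.symm
  · refine (congrArg (IsOpen[(FunSpace.ofAlgebra A).top]) (Set.ext fun x => ?_)).mpr (hpre _ hO)
    constructor
    · rintro ⟨hx, h⟩
      obtain ⟨z, hz, -⟩ := hg1' x hx
      refine ⟨hx, z, hz, ?_⟩
      show (f x, Z.emb m z) ∈ O
      rw [hz]; exact h
    · rintro ⟨hx, z, hz, h⟩
      refine ⟨hx, ?_⟩
      have h' : (f x, Z.emb m z) ∈ O := h
      rw [hz] at h'
      exact h'

end Pair

section Coordinates

variable {σ τ : Type}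

lemma torusAlgebra_coord (k : σ) : (fun t : σ → ℂˣ => (t k : ℂ)) ∈ torusAlgebra σ :=
  Algebra.subset_adjoin (Or.inl ⟨k, rfl⟩)

lemma torusAlgebra_coord_inv (k : σ) : (fun t : σ → ℂˣ => ((t k)⁻¹ : ℂ)) ∈ torusAlgebra σ :=
  Algebra.subset_adjoin (Or.inr ⟨k, rfl⟩)

lemma isMorphismOn_coord (k : σ) :
    IsMorphismOn (torus σ) Gm Set.univ (fun t : σ → ℂˣ => t k) := by
  refine isMorphismOn_of_comp_mem (φ := fun t : σ → ℂˣ => t k) fun b hb => ?_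
  induction hb using Algebra.adjoin_induction with
  | mem b hb =>
    rcases hb with rfl | rfl
    · exact torusAlgebra_coord k
    · exact torusAlgebra_coord_inv k
  | algebraMap r => exact (torusAlgebra σ).algebraMap_mem r
  | add x y _ _ hx hy => exact add_mem hx hy
  | mul x y _ _ hx hy => exact mul_mem hx hy

lemma isMorphismOn_reindex (r : τ → σ) :
    IsMorphismOn (torus σ) (torus τ) Set.univ (fun (t : σ → ℂˣ) k => t (r k)) := by
  refine isMorphismOn_of_comp_mem (φ := fun (t : σ → ℂˣ) k => t (r k)) fun b hb => ?_
  induction hb using Algebra.adjoin_induction with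
  | mem b hb =>
    rcases hb with ⟨k, rfl⟩ | ⟨k, rfl⟩
    · exact torusAlgebra_coord (r k)
    · exact torusAlgebra_coord_inv (r k)
  | algebraMap r => exact (torusAlgebra σ).algebraMap_mem r
  | add x y _ _ hx hy => exact add_mem hx hy
  | mul x y _ _ hx hy => exact mul_mem hx hy

/-- A map to a torus with regular coordinates is continuous. -/
lemma isOpen_preimage_of_regAt {U : Set (σ → ℂˣ)} (hU : IsOpen[zar σ] U)
    {F : (σ → ℂˣ) → τ → ℂˣ}
    (hF : ∀ x ∈ U, ∀ k, (FunSpace.ofAlgebra (torusAlgebra σ)).RegAt (fun t => (F t k : ℂ)) x)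
    {O : Set (τ → ℂˣ)} (hO : IsOpen[zar τ] O) : IsOpen[zar σ] (U ∩ F ⁻¹' O) := by
  let _ : TopologicalSpace (σ → ℂˣ) := zar σ
  have hreg : ∀ a ∈ torusAlgebra τ, ∀ x ∈ U,
      (FunSpace.ofAlgebra (torusAlgebra σ)).RegAt (fun t => a (F t)) x := by
    intro a ha x hx
    induction ha using Algebra.adjoin_induction with
    | mem b hb =>
      rcases hb with ⟨k, rfl⟩ | ⟨k, rfl⟩
      · exact hF x hx k
      · exact FunSpace.RegAt.inv (hF x hx k) (Units.ne_zero _)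
    | algebraMap r => exact FunSpace.regAt_const r x
    | add x y _ _ hx hy => exact FunSpace.RegAt.add hx hy
    | mul x y _ _ hx hy => exact FunSpace.RegAt.mul hx hy
  show IsOpen (U ∩ F ⁻¹' O)
  rw [isOpen_iff_mem_nhds]
  rintro x ⟨hx, hxO⟩
  obtain ⟨a, ha, hax, haO⟩ := (FunSpace.isOpen_ofAlgebra_iff _ _).1 hO _ hxO
  filter_upwards [hU.mem_nhds hx, FunSpace.RegAt.eventually_ne (hreg a ha x hx) hax] with t h1 h2
  exact ⟨h1, haO _ h2⟩

lemma IsMorphismOn.regAt_coord {U : Set (σ → ℂˣ)} {F : (σ → ℂˣ) → τ → ℂˣ}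
    (hF : IsMorphismOn (torus σ) (torus τ) U F) {x : σ → ℂˣ} (hx : x ∈ U) (k : τ) :
    (FunSpace.ofAlgebra (torusAlgebra σ)).RegAt (fun t => (F t k : ℂ)) x := by
  obtain ⟨m, h, -⟩ := hF 0
  obtain ⟨y, -, hreg⟩ := h x hx
  exact hreg (fun t => (t k : ℂ)) (FunSpace.regAt_of_mem (torusAlgebra_coord k) y)

end Coordinates

/-- The constant function `1` is regular. -/
def FunSpace.HasOne {X : Type*} (S : FunSpace X) : Prop := ∀ x, S.RegAt (fun _ => 1) x

lemma FunSpace.hasOne_ofAlgebra {X : Type*} (A : Subalgebra ℂ (X → ℂ)) :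
    (FunSpace.ofAlgebra A).HasOne := fun _ =>
  ⟨1, one_mem _, 1, one_mem _, one_ne_zero, Filter.Eventually.of_forall fun y => by simp⟩

/-- Regularity is an abstract predicate, so even the constant `1` needs an affine chart: there `1`
agrees locally with a regular function of the ambient space. It serves to make `Y × W` open in the
product topology, whose generators are cut out by tensors. -/
lemma FunSpace.IsVariety.hasOne {X : Type*} {S : FunSpace X} (h : S.IsVariety) : S.HasOne := by
  intro x
  obtain ⟨⟨n, U, hU, hcov, haff⟩, -⟩ := h
  obtain ⟨k, hk⟩ := Set.mem_iUnion.1 (hcov.symm ▸ Set.mem_univ x : x ∈ ⋃ k, U k)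
  obtain ⟨A, -, -, hA⟩ := haff k
  have h1 : (S.induced (Subtype.val : U k → X)).RegAt (fun _ => 1) ⟨x, hk⟩ := by
    rw [hA]; exact FunSpace.hasOne_ofAlgebra A _
  obtain ⟨g, hg, hev⟩ := h1
  refine S.germ g _ x ?_ hg
  obtain ⟨W, hW, ⟨V, hV, rfl⟩, hxW⟩ := exists_isOpen_of_eventually hev
  filter_upwards [mem_nhds_of_isOpen hV hxW, mem_nhds_of_isOpen (hU k) hk] with y h1 h2
  exact (hW ⟨y, h2⟩ h1).symm

lemma FunSpace.HasOne.prod {X Y : Type*} {S : FunSpace X} {R : FunSpace Y} (hS : S.HasOne)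
    (hR : R.HasOne) : (S.prod R).HasOne := by
  intro p
  have h1 : (fun _ => 1 : X × Y → ℂ) ∈ FunSpace.tensor S R Set.univ Set.univ :=
    Submodule.subset_span ⟨fun _ => 1, fun _ => 1, fun x _ => hS x, fun y _ => hR y, by simp⟩
  exact ⟨Set.univ, Set.univ, @isOpen_univ _ S.top, @isOpen_univ _ R.top, trivial, trivial,
    _, h1, _, h1, one_ne_zero, Filter.Eventually.of_forall fun y => by simp⟩

/-- The slice `Y × W` of a product is open. -/
lemma IndSpace.isOpen_snd {Y : Type} {S : FunSpace Y} (hS : S.HasOne) {X : IndSpace.{u}}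
    (hX : ∀ n, (X.sp n).HasOne) {W : Set X.carrier} (hW : IsOpen[X.top] W) :
    IsOpen[((IndSpace.const S).prod X).top] {p : Y × X.carrier | p.2 ∈ W} := by
  rw [IndSpace.isOpen_top_iff]
  intro n
  refine TopologicalSpace.isOpen_generateFrom_of_mem
    ⟨Set.univ, X.emb n ⁻¹' W, @isOpen_univ _ S.top, (X.isOpen_top_iff W).1 hW n, fun _ => 1, ?_, ?_⟩
  · exact Submodule.subset_span
      ⟨fun _ => 1, fun _ => 1, fun x _ => hS x, fun y _ => hX n y, by simp⟩
  · ext p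
    constructor
    · exact fun h => ⟨trivial, h, one_ne_zero⟩
    · exact fun h => h.2.1

end Morphisms

/-! ### Tropicalization and logarithmic coordinates -/

section Tropical

variable {σ κ : Type}

lemma IsPositivePoly.re_pos {P : MvPolynomial σ ℂ} (hP : IsPositivePoly P) {m : σ →₀ ℕ}
    (hm : m ∈ P.support) : 0 < (P.coeff m).re := by
  obtain ⟨r, hr, h⟩ := hP.2 m
  have := MvPolynomial.mem_support_iff.1 hm
  rw [h] at this ⊢
  rw [Complex.ofReal_re]
  exact lt_of_le_of_ne hr fun h0 => this (by rw [← h0, Complex.ofReal_zero])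

/-- The sequence `x` of real vectors stays at bounded distance from the ray `s ↦ s l`. -/
def Near (x : ℕ → σ → ℝ) (l : σ → ℤ) : Prop := ∃ C : ℝ, ∀ (s : ℕ) k, |x s k - s * l k| ≤ C

lemma near_ray (l : σ → ℤ) : Near (fun s k => s * l k) l := ⟨0, fun s k => by simp⟩

/-- Distinct integral slopes differ by at least `1` in some coordinate, so the two rays separate
linearly in `s`. -/
lemma Near.unique {x : ℕ → σ → ℝ} {l l' : σ → ℤ} (h : Near x l) (h' : Near x l') : l = l' := by
  obtain ⟨C, hC⟩ := h
  obtain ⟨C', hC'⟩ := h'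
  funext k
  by_contra hne
  obtain ⟨s, hs⟩ := exists_nat_gt (C + C')
  have h1 := abs_le.1 (hC s k)
  have h2 := abs_le.1 (hC' s k)
  have h3 : |(s : ℝ) * (l k - l' k)| ≤ C + C' := by
    rw [abs_le]; constructor <;> nlinarith
  rw [abs_mul, Nat.abs_cast] at h3
  have h4 : (1 : ℝ) ≤ |(l k : ℝ) - l' k| := by
    exact_mod_cast Int.one_le_abs (sub_ne_zero.2 hne)
  nlinarith [(Nat.cast_nonneg s : (0 : ℝ) ≤ s)]

variable [Fintype σ]

/-- The weight of a monomial at a co-character. -/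
def monoWeight (l : σ → ℤ) (m : σ →₀ ℕ) : ℤ := ∑ i, m i * l i

/-- `M` is the value at `l` of the tropicalization (in the max-plus convention) of `P`. -/
def IsTrop (P : MvPolynomial σ ℂ) (l : σ → ℤ) (M : ℤ) : Prop :=
  (∀ m ∈ P.support, monoWeight l m ≤ M) ∧ ∃ m ∈ P.support, monoWeight l m = M

lemma exists_isTrop {P : MvPolynomial σ ℂ} (hP : P ≠ 0) (l : σ → ℤ) : ∃ M, IsTrop P l M := by
  obtain ⟨m, hm, hmax⟩ := P.support.exists_max_image (monoWeight l)
    (MvPolynomial.support_nonempty.2 hP)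
  exact ⟨monoWeight l m, hmax, m, hm, rfl⟩

/-- The initial form of `P` with respect to the weight `l`, where `M` is the maximal weight. -/
def initialForm (P : MvPolynomial σ ℂ) (l : σ → ℤ) (M : ℤ) : MvPolynomial σ ℂ :=
  ∑ m ∈ P.support with monoWeight l m = M, MvPolynomial.monomial m (P.coeff m)

lemma initialForm_ne_zero {P : MvPolynomial σ ℂ} {l : σ → ℤ} {M : ℤ} (h : IsTrop P l M) :
    initialForm P l M ≠ 0 := by
  classical
  obtain ⟨m, hm, hM⟩ := h.2
  intro h0
  have := congrArg (MvPolynomial.coeff m) h0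
  rw [initialForm, MvPolynomial.coeff_sum, MvPolynomial.coeff_zero] at this
  simp only [MvPolynomial.coeff_monomial] at this
  rw [Finset.sum_ite_eq_of_mem' _ _ _ (Finset.mem_filter.2 ⟨hm, hM⟩)] at this
  exact MvPolynomial.mem_support_iff.1 hm this

lemma order_leadingCoeff_prod {R : Type*} [Field R] {α : Type*} (s : Finset α)
    (f : α → LaurentSeries R) (hf : ∀ i, f i ≠ 0) :
    (∏ i ∈ s, f i).order = ∑ i ∈ s, (f i).order ∧
      (∏ i ∈ s, f i).leadingCoeff = ∏ i ∈ s, (f i).leadingCoeff := by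
  classical
  induction s using Finset.induction_on with
  | empty => simp
  | insert a s ha ih =>
    rw [Finset.prod_insert ha, Finset.sum_insert ha, Finset.prod_insert ha,
      HahnSeries.order_mul (hf a) (Finset.prod_ne_zero_iff.2 fun i _ => hf i),
      HahnSeries.leadingCoeff_mul, ih.1, ih.2]
    exact ⟨rfl, rfl⟩

lemma leadingCoeff_pow' {R : Type*} [Field R] (x : LaurentSeries R) (n : ℕ) :
    (x ^ n).leadingCoeff = x.leadingCoeff ^ n := by
  induction n with
  | zero => simp
  | succ n ih => rw [pow_succ, HahnSeries.leadingCoeff_mul, ih, pow_succ]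

lemma monomial_loop (φ : Loop σ) (m : σ →₀ ℕ) :
    (∏ i, (φ i : LaurentSeries ℂ) ^ m i).order = -monoWeight (loopDeg φ) m ∧
      (∏ i, (φ i : LaurentSeries ℂ) ^ m i).leadingCoeff = ∏ i, loopLead φ i ^ m i := by
  obtain ⟨h1, h2⟩ := order_leadingCoeff_prod Finset.univ
    (fun i => (φ i : LaurentSeries ℂ) ^ m i) (fun i => pow_ne_zero _ (Units.ne_zero _))
  refine ⟨?_, ?_⟩
  · rw [h1, monoWeight, ← Finset.sum_neg_distrib]
    refine Finset.sum_congr rfl fun i _ => ?_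
    rw [HahnSeries.order_pow, loopDeg]
    simp
  · rw [h2]
    exact Finset.prod_congr rfl fun i _ => leadingCoeff_pow' _ _

/-- A monomial of weight `w` contributes a series of order `-w`. Nothing occurs below `c ^ (-M)`,
and the coefficient there is the initial form evaluated at the leading coefficients. -/
lemma order_aeval_loop {P : MvPolynomial σ ℂ} {l : σ → ℤ} {M : ℤ} (h : IsTrop P l M) (φ : Loop σ)
    (hφ : loopDeg φ = l) (hne : MvPolynomial.eval (loopLead φ) (initialForm P l M) ≠ 0) :
    MvPolynomial.aeval (fun i => (φ i : LaurentSeries ℂ)) P ≠ 0 ∧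
      (MvPolynomial.aeval (fun i => (φ i : LaurentSeries ℂ)) P).order = -M := by
  have hco : ∀ j, (MvPolynomial.aeval (fun i => (φ i : LaurentSeries ℂ)) P).coeff j =
      ∑ m ∈ P.support, P.coeff m * (∏ i, (φ i : LaurentSeries ℂ) ^ m i).coeff j := by
    intro j
    rw [MvPolynomial.aeval_def, MvPolynomial.eval₂_eq', HahnSeries.coeff_sum]
    refine Finset.sum_congr rfl fun m _ => ?_
    rw [LaurentSeries.algebraMap_apply, HahnSeries.C_mul_eq_smul, HahnSeries.coeff_smul, smul_eq_mul]
  have hlt : ∀ j, j < -M →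
      (MvPolynomial.aeval (fun i => (φ i : LaurentSeries ℂ)) P).coeff j = 0 := by
    intro j hj
    rw [hco]
    refine Finset.sum_eq_zero fun m hm => ?_
    rw [HahnSeries.coeff_eq_zero_of_lt_order, mul_zero]
    rw [(monomial_loop φ m).1, hφ]
    have := h.1 m hm
    omega
  have hM : (MvPolynomial.aeval (fun i => (φ i : LaurentSeries ℂ)) P).coeff (-M) ≠ 0 := by
    rw [hco]
    convert hne using 1
    rw [initialForm, map_sum, Finset.sum_filter]
    refine Finset.sum_congr rfl fun m hm => ?_
    split_ifs with hw
    · rw [MvPolynomial.eval_monomial, Finsupp.prod_fintype _ _ (by simp),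
        ← (monomial_loop φ m).2, HahnSeries.leadingCoeff_eq, (monomial_loop φ m).1, hφ, hw]
    · rw [HahnSeries.coeff_eq_zero_of_lt_order, mul_zero]
      rw [(monomial_loop φ m).1, hφ]
      have := lt_of_le_of_ne (h.1 m hm) hw
      omega
  have h0 : MvPolynomial.aeval (fun i => (φ i : LaurentSeries ℂ)) P ≠ 0 := by
    intro h0
    rw [h0] at hM
    exact hM rfl
  refine ⟨h0, le_antisymm (HahnSeries.order_le_of_coeff_ne_zero hM) ?_⟩
  rw [HahnSeries.le_order_iff_forall h0]
  exact hlt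

/-- The value of a polynomial with nonnegative coefficients at a point with positive coordinates, in
logarithmic coordinates. -/
def posEval (P : MvPolynomial σ ℂ) (u : σ → ℝ) : ℝ :=
  ∑ m ∈ P.support, (P.coeff m).re * Real.exp (∑ i, m i * u i)

lemma IsPositivePoly.posEval_pos {P : MvPolynomial σ ℂ} (hP : IsPositivePoly P) (u : σ → ℝ) :
    0 < posEval P u :=
  Finset.sum_pos (fun _ hm => mul_pos (hP.re_pos hm) (Real.exp_pos _))
    (MvPolynomial.support_nonempty.2 hP.1)

lemma IsPositivePoly.eval_expPoint {P : MvPolynomial σ ℂ} (hP : IsPositivePoly P) (u : σ → ℝ) :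
    MvPolynomial.eval (fun i => (expPoint u i : ℂ)) P = (posEval P u : ℂ) := by
  rw [MvPolynomial.eval_eq', posEval, Complex.ofReal_sum]
  refine Finset.sum_congr rfl fun m _ => ?_
  obtain ⟨r, hr, h⟩ := hP.2 m
  rw [h, Complex.ofReal_re, Complex.ofReal_mul, Real.exp_sum, Complex.ofReal_prod]
  congr 1
  refine Finset.prod_congr rfl fun i _ => ?_
  rw [Real.exp_nat_mul]
  simp [expPoint]

lemma continuous_posEval (P : MvPolynomial σ ℂ) : Continuous (posEval P) := by
  unfold posEval
  fun_prop

/-- Positivity excludes cancellation: `P` is at least its dominant monomial and at most the sum of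
its coefficients times the largest exponential, and both bounds have logarithm `s M + O(1)`. -/
lemma IsPositivePoly.log_posEval_near {P : MvPolynomial σ ℂ} (hP : IsPositivePoly P) {l : σ → ℤ}
    {M : ℤ} (h : IsTrop P l M) {x : ℕ → σ → ℝ} (hx : Near x l) :
    ∃ C : ℝ, ∀ s : ℕ, |Real.log (posEval P (x s)) - s * M| ≤ C := by
  obtain ⟨C, hC⟩ := hx
  -- Nonnegativity is only available through an index: for empty `σ` the constant `C` is
  -- unconstrained.
  have hC0 : ∀ i : σ, 0 ≤ C := fun i => (abs_nonneg _).trans (hC 0 i)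
  have hmono : ∀ (s : ℕ) (m : σ →₀ ℕ),
      |(∑ i, (m i : ℝ) * x s i) - s * monoWeight l m| ≤ ∑ i, m i * C := by
    intro s m
    have : (∑ i, (m i : ℝ) * x s i) - s * monoWeight l m =
        ∑ i, (m i : ℝ) * (x s i - s * l i) := by
      rw [monoWeight]
      push_cast
      rw [Finset.mul_sum, ← Finset.sum_sub_distrib]
      exact Finset.sum_congr rfl fun i _ => by ring
    rw [this]
    refine (Finset.abs_sum_le_sum_abs _ _).trans (Finset.sum_le_sum fun i _ => ?_)
    rw [abs_mul, Nat.abs_cast]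
    exact mul_le_mul_of_nonneg_left (hC s i) (Nat.cast_nonneg _)
  have hm0 : ∀ m : σ →₀ ℕ, (0 : ℝ) ≤ ∑ i, m i * C := fun m =>
    Finset.sum_nonneg fun i _ => mul_nonneg (Nat.cast_nonneg _) (hC0 i)
  -- A crude error bound that serves all monomials of `P` at once.
  set K : ℝ := ∑ m ∈ P.support, ∑ i, (m i : ℝ) * C with hK
  have hmK : ∀ m ∈ P.support, ∑ i, (m i : ℝ) * C ≤ K := fun m hm =>
    Finset.single_le_sum (f := fun m : σ →₀ ℕ => ∑ i, (m i : ℝ) * C) (fun m _ => hm0 m) hm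
  obtain ⟨m₀, hm₀, hM₀⟩ := h.2
  set a : ℝ := ∑ m ∈ P.support, (P.coeff m).re with ha
  have ha0 : 0 < a := Finset.sum_pos (fun _ hm => hP.re_pos hm)
    (MvPolynomial.support_nonempty.2 hP.1)
  have hup : ∀ s : ℕ, Real.log (posEval P (x s)) ≤ Real.log a + (s * M + K) := by
    intro s
    rw [← Real.log_exp ((s : ℝ) * M + K), ← Real.log_mul ha0.ne' (Real.exp_ne_zero _)]
    refine Real.log_le_log (hP.posEval_pos _) ?_
    rw [ha, Finset.sum_mul]
    refine Finset.sum_le_sum fun m hm => mul_le_mul_of_nonneg_left ?_ (hP.re_pos hm).le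
    refine Real.exp_le_exp.2 ?_
    have h1 := (abs_le.1 (hmono s m)).2
    have h2 := hmK m hm
    have h3 : (s : ℝ) * monoWeight l m ≤ s * M :=
      mul_le_mul_of_nonneg_left (by exact_mod_cast h.1 m hm) (Nat.cast_nonneg _)
    linarith
  have hlow : ∀ s : ℕ, Real.log (P.coeff m₀).re + (s * M - K) ≤ Real.log (posEval P (x s)) := by
    intro s
    have hp := hP.re_pos hm₀
    rw [← Real.log_exp ((s : ℝ) * M - K), ← Real.log_mul hp.ne' (Real.exp_ne_zero _)]
    refine Real.log_le_log (mul_pos hp (Real.exp_pos _)) ?_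
    refine le_trans ?_ (Finset.single_le_sum
      (f := fun m => (P.coeff m).re * Real.exp (∑ i, (m i : ℝ) * x s i))
      (fun m hm => (mul_pos (hP.re_pos hm) (Real.exp_pos _)).le) hm₀)
    refine mul_le_mul_of_nonneg_left (Real.exp_le_exp.2 ?_) hp.le
    have h1 := (abs_le.1 (hmono s m₀)).1
    have h2 := hmK m₀ hm₀
    rw [hM₀] at h1
    linarith
  refine ⟨|Real.log a + K| + |Real.log (P.coeff m₀).re - K|, fun s => ?_⟩
  have h1 := hup s
  have h2 := hlow s
  have h3 := le_abs_self (Real.log a + K)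
  have h4 := neg_abs_le (Real.log (P.coeff m₀).re - K)
  have h5 := abs_nonneg (Real.log a + K)
  have h6 := abs_nonneg (Real.log (P.coeff m₀).re - K)
  rw [abs_le]
  constructor <;> linarith

/-- Otherwise the difference of the cross products would be nonzero at some positive point where
both quotient formulas hold. -/
lemma IsQuotient.mul_eq_mul {g : (σ → ℂˣ) →. ℂˣ} {P Q P' Q' : MvPolynomial σ ℂ}
    (h : IsQuotient g P Q) (h' : IsQuotient g P' Q') : P * Q' = P' * Q := by
  obtain ⟨W, hW, h⟩ := h
  obtain ⟨W', hW', h'⟩ := h'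
  by_contra hne
  obtain ⟨u, hu, h1, h2⟩ := residual_exists
    ((residual_eval_ne_zero (sub_ne_zero.2 hne)).and (hW.residual.and hW'.residual))
  obtain ⟨y, hy, hq, hyq⟩ := h _ h1
  obtain ⟨y', hy', hq', hyq'⟩ := h' _ h2
  obtain rfl := Part.mem_unique hy hy'
  apply hu
  rw [hyq, div_eq_div_iff hq hq'] at hyq'
  simp only [map_sub, map_mul, hyq', sub_self]

/-- The monomial loop `u_i c ^ (-l_i)`, with `u` off the zeros of `H` and `H'`, is generic for both
conditions, and its image does not depend on the chosen quotients. Hence the choice in `ultraDeg` is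
determined as soon as a target component exists. -/
lemma MapsComponent.unique {f : (σ → ℂˣ) →. (κ → ℂˣ)} {l : σ → ℤ} {m m' : κ → ℤ}
    (h : MapsComponent f l m) (h' : MapsComponent f l m') : m = m' := by
  obtain ⟨H, hH, h⟩ := h
  obtain ⟨H', hH', h'⟩ := h'
  obtain ⟨u, hu⟩ := residual_exists (residual_eval_ne_zero (mul_ne_zero hH hH'))
  rw [map_mul] at hu
  have hs : ∀ i, (HahnSeries.single (-l i) (expPoint u i : ℂ) : LaurentSeries ℂ) ≠ 0 := fun i =>
    HahnSeries.single_ne_zero (Units.ne_zero _)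
  let φ : Loop σ := fun i => Units.mk0 _ (hs i)
  have hdeg : loopDeg φ = l := by
    funext i
    simp [loopDeg, φ, HahnSeries.order_single (Units.ne_zero (expPoint u i))]
  have hlead : loopLead φ = fun i => (expPoint u i : ℂ) := by
    funext i
    simp only [loopLead, φ, Units.val_mk0, HahnSeries.leadingCoeff_of_single]
  obtain ⟨ψ, hψ, hm⟩ := h φ hdeg (by rw [hlead]; exact left_ne_zero_of_mul hu)
  obtain ⟨ψ', hψ', hm'⟩ := h' φ hdeg (by rw [hlead]; exact right_ne_zero_of_mul hu)
  have : ψ = ψ' := by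
    funext k
    obtain ⟨P, Q, hPQ, hQ, e⟩ := hm k
    obtain ⟨P', Q', hPQ', hQ', e'⟩ := hm' k
    have hmul := congrArg (MvPolynomial.aeval fun i => (φ i : LaurentSeries ℂ))
      (hPQ.mul_eq_mul hPQ')
    rw [map_mul, map_mul, ← e, ← e'] at hmul
    apply Units.ext
    apply mul_right_cancel₀ (mul_ne_zero hQ hQ')
    rw [← mul_assoc, hmul]
    ring
  rw [← hψ, ← hψ', this]

lemma ultraDeg_eq {f : (σ → ℂˣ) →. (κ → ℂˣ)} {l : σ → ℤ} {m : κ → ℤ}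
    (h : MapsComponent f l m) : ultraDeg f l = m :=
  MapsComponent.unique (Classical.epsilon_spec ⟨m, h⟩) h

/-- `H` is the product of all initial forms. Where it does not vanish, each numerator has order `-p
k` and each denominator order `-q k`, so the degree is the tropical numerator minus the tropical
denominator. -/
lemma mapsComponent_of_quotient [Fintype κ] {f : (σ → ℂˣ) →. (κ → ℂˣ)}
    {P Q : κ → MvPolynomial σ ℂ} (hf : ∀ k, IsQuotient (fun t => (f t).map fun y => y k) (P k) (Q k))
    {l : σ → ℤ} {p q : κ → ℤ} (hp : ∀ k, IsTrop (P k) l (p k)) (hq : ∀ k, IsTrop (Q k) l (q k)) :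
    MapsComponent f l (p - q) := by
  refine ⟨∏ k, (initialForm (P k) l (p k) * initialForm (Q k) l (q k)),
    Finset.prod_ne_zero_iff.2 fun k _ =>
      mul_ne_zero (initialForm_ne_zero (hp k)) (initialForm_ne_zero (hq k)), fun φ hφ hne => ?_⟩
  rw [map_prod, Finset.prod_ne_zero_iff] at hne
  have hne' : ∀ k, _ ∧ _ := fun k => mul_ne_zero_iff.1 ((map_mul (MvPolynomial.eval (loopLead φ)) _ _)
    ▸ hne k (Finset.mem_univ k))
  have hP := fun k => order_aeval_loop (hp k) φ hφ (hne' k).1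
  have hQ := fun k => order_aeval_loop (hq k) φ hφ (hne' k).2
  refine ⟨fun k => Units.mk0 _ (div_ne_zero (hP k).1 (hQ k).1), ?_, fun k =>
    ⟨P k, Q k, hf k, (hQ k).1, div_mul_cancel₀ _ (hQ k).1⟩⟩
  funext k
  have h1 := HahnSeries.order_mul (div_ne_zero (hP k).1 (hQ k).1) (hQ k).1
  rw [div_mul_cancel₀ _ (hQ k).1, (hP k).2, (hQ k).2] at h1
  simp only [loopDeg, Units.val_mk0, Pi.sub_apply]
  omega

/-- A positive rational morphism of tori in logarithmic coordinates. -/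
structure IsLogMap (f : (σ → ℂˣ) →. (κ → ℂˣ)) (F : (σ → ℝ) → κ → ℝ) : Prop where
  continuous : Continuous F
  generic : ∃ W, IsOpen[zar σ] W ∧ W.Nonempty ∧ ∀ u, expPoint u ∈ W → expPoint (F u) ∈ f (expPoint u)
  near : ∀ l x, Near x l → Near (fun s => F (x s)) (ultraDeg f l)
  rational : ∀ k, ∃ P Q : MvPolynomial σ ℂ, ∀ u,
    MvPolynomial.eval (fun i => (expPoint u i : ℂ)) Q ≠ 0 ∧
    (expUnit (F u k) : ℂ) * MvPolynomial.eval (fun i => (expPoint u i : ℂ)) Q =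
      MvPolynomial.eval (fun i => (expPoint u i : ℂ)) P

/-- `F k` is `log P k - log Q k`, defined everywhere because positive polynomials have no zeros at
positive points. Along a near-ray it grows with slope `p k - q k`, which is also the degree on
loops. -/
lemma IsPositive.exists_isLogMap [Fintype κ] {f : (σ → ℂˣ) →. (κ → ℂˣ)} (hf : IsPositive f) :
    ∃ F, IsLogMap f F := by
  classical
  have hcoord : ∀ k, ∃ P Q, IsPositivePoly P ∧ IsPositivePoly Q ∧
      IsQuotient (fun t => (f t).map fun y => y k) P Q := by
    intro k
    obtain ⟨P, Q, hP, hQ, h⟩ := hf (Pi.single k 1)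
    refine ⟨P, Q, hP, hQ, ?_⟩
    have : torusChar (Pi.single k 1) = fun y : κ → ℂˣ => y k := by
      funext y
      rw [torusChar, Finset.prod_eq_single k]
      · simp
      · intro j _ hj
        simp [hj]
      · simp
    rwa [this] at h
  choose P Q hP hQ hPQ using hcoord
  have hexp : ∀ u k, Real.exp (Real.log (posEval (P k) u) - Real.log (posEval (Q k) u)) =
      posEval (P k) u / posEval (Q k) u := fun u k => by
    rw [Real.exp_sub, Real.exp_log ((hP k).posEval_pos u), Real.exp_log ((hQ k).posEval_pos u)]
  refine ⟨fun u k => Real.log (posEval (P k) u) - Real.log (posEval (Q k) u), ?_, ?_, ?_, ?_⟩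
  · exact continuous_pi fun k =>
      ((continuous_posEval _).log fun u => ((hP k).posEval_pos u).ne').sub
        ((continuous_posEval _).log fun u => ((hQ k).posEval_pos u).ne')
  · choose W hW hWe using hPQ
    -- The trivial character provides an open set where `f` is defined; the coordinates alone would
    -- not do so when `κ` is empty.
    obtain ⟨_, _, _, _, W₀, hW₀, hW₀e⟩ := hf 0
    refine ⟨W₀ ∩ ⋂ k, W k, ?_, ?_, ?_⟩
    · exact isOpen_inter_of hW₀.isOpen_zar
        (@isOpen_iInter_of_finite _ _ (zar σ) _ _ fun k => (hW k).isOpen_zar)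
    · obtain ⟨u, hu, hu'⟩ := residual_exists
        (hW₀.residual.and (Filter.eventually_all.2 fun k => (hW k).residual))
      exact ⟨_, hu, Set.mem_iInter.2 hu'⟩
    · rintro u ⟨hu, hu'⟩
      obtain ⟨y₀, hy₀, -⟩ := hW₀e _ hu
      obtain ⟨z, hz, -⟩ := (Part.mem_map_iff _).1 hy₀
      convert hz using 1
      funext k
      obtain ⟨y, hy, hne, hyq⟩ := hWe k _ (Set.mem_iInter.1 hu' k)
      obtain ⟨z', hz', rfl⟩ := (Part.mem_map_iff _).1 hy
      obtain rfl := Part.mem_unique hz hz'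
      apply Units.ext
      rw [hyq, (hP k).eval_expPoint, (hQ k).eval_expPoint, expPoint, expUnit_val, hexp,
        Complex.ofReal_div]
  · intro l x hx
    choose p hp using fun k => exists_isTrop (hP k).1 l
    choose q hq using fun k => exists_isTrop (hQ k).1 l
    rw [ultraDeg_eq (mapsComponent_of_quotient hPQ hp hq)]
    choose C hC using fun k => (hP k).log_posEval_near (hp k) hx
    choose C' hC' using fun k => (hQ k).log_posEval_near (hq k) hx
    refine ⟨∑ k, (C k + C' k), fun s k => ?_⟩
    refine le_trans ?_ (Finset.single_le_sum (f := fun k => C k + C' k)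
      (fun k _ => add_nonneg ((abs_nonneg _).trans (hC k 0)) ((abs_nonneg _).trans (hC' k 0)))
      (Finset.mem_univ k))
    have h1 := abs_le.1 (hC k s)
    have h2 := abs_le.1 (hC' k s)
    rw [abs_le]
    simp only [Pi.sub_apply, Int.cast_sub]
    constructor <;> linarith
  · refine fun k => ⟨P k, Q k, fun u => ?_⟩
    rw [(hP k).eval_expPoint, (hQ k).eval_expPoint, expUnit_val, hexp]
    have h0 : (posEval (Q k) u : ℂ) ≠ 0 := by exact_mod_cast ((hQ k).posEval_pos u).ne'
    exact ⟨h0, by rw [Complex.ofReal_div, div_mul_cancel₀ _ h0]⟩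

end Tropical

/-! ### Birational charts by a torus -/

section Charts

lemma RatMor.mem_part {X : IndSpace.{u}} {Y : IndSpace.{v}} {f : RatMor X Y} {x : X.carrier}
    {y : Y.carrier} : y ∈ f.part x ↔ x ∈ f.dom ∧ f.map x = y :=
  ⟨fun ⟨h, e⟩ => ⟨h, e⟩, fun ⟨h, e⟩ => ⟨h, e⟩⟩

lemma IndSpace.OpenDense.inter {X : IndSpace.{u}} {U V : Set X.carrier} (hU : X.OpenDense U)
    (hV : X.OpenDense V) : X.OpenDense (U ∩ V) := by
  let _ : TopologicalSpace X.carrier := X.top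
  exact ⟨isOpen_inter_of hU.1 hV.1, hU.2.inter_of_isOpen_left hV.2 hU.1⟩

lemma IndSpace.OpenDense.inter_open_nonempty {X : IndSpace.{u}} {U V : Set X.carrier}
    (hU : X.OpenDense U) (hV : IsOpen[X.top] V) (hne : V.Nonempty) : (V ∩ U).Nonempty := by
  let _ : TopologicalSpace X.carrier := X.top
  exact hU.2.inter_open_nonempty V hV hne

lemma Gm_hasOne (n : ℕ) : (Gm.sp n).HasOne := FunSpace.hasOne_ofAlgebra _

variable {ι : Type} {X : IndSpace.{u}} (Θ : TorusChart ι X)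

lemma TorusChart.exists_left_inv : ∃ W, IsOpen[zar ι] W ∧ W.Nonempty ∧
    ∀ t ∈ W, t ∈ Θ.θ.dom ∧ Θ.θ.map t ∈ Θ.inv.dom ∧ Θ.inv.map (Θ.θ.map t) = t := by
  obtain ⟨W, hW, h⟩ := Θ.left_inv
  refine ⟨W, hW.isOpen_zar, hW.torus_nonempty, fun t ht => ?_⟩
  obtain ⟨z, hz, hz'⟩ := h t ht
  obtain rfl := (Part.mem_some_iff.1 hz')
  obtain ⟨x, hx, hx'⟩ := Part.mem_bind_iff.1 hz
  obtain ⟨h1, rfl⟩ := RatMor.mem_part.1 hx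
  obtain ⟨h2, h3⟩ := RatMor.mem_part.1 hx'
  exact ⟨h1, h2, h3⟩

/-- The points at which `θ ∘ θ⁻¹` is defined and the identity. -/
def TorusChart.rightInv : Set X.carrier :=
  {x | x ∈ Θ.inv.dom ∧ Θ.inv.map x ∈ Θ.θ.dom ∧ Θ.θ.map (Θ.inv.map x) = x}

lemma TorusChart.exists_right_inv : ∃ W, X.OpenDense W ∧ W ⊆ Θ.rightInv := by
  obtain ⟨W, hW, h⟩ := Θ.right_inv
  refine ⟨W, hW, fun x hx => ?_⟩
  obtain ⟨z, hz, hz'⟩ := h x hx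
  obtain rfl := (Part.mem_some_iff.1 hz')
  obtain ⟨t, ht, ht'⟩ := Part.mem_bind_iff.1 hz
  obtain ⟨h1, rfl⟩ := RatMor.mem_part.1 ht
  obtain ⟨h2, h3⟩ := RatMor.mem_part.1 ht'
  exact ⟨h1, h2, h3⟩

lemma TorusChart.carrier_nonempty (Θ : TorusChart ι X) : Nonempty X.carrier := ⟨Θ.θ.map (1 : ι → ℂˣ)⟩

variable {σ κ : Type}

lemma TorusChart.isOpen_dom (r : ι → σ) :
    IsOpen[zar σ] {s : σ → ℂˣ | (fun k => s (r k)) ∈ Θ.θ.dom} := by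
  have := (isMorphismOn_reindex r).isOpen_preimage (O := Θ.θ.dom) Θ.θ.openDense.1
  rw [torus_top, Set.univ_inter] at this
  exact this

lemma TorusChart.isMorphismOn_reindex (r : ι → σ) :
    IsMorphismOn (torus σ) X {s : σ → ℂˣ | (fun k => s (r k)) ∈ Θ.θ.dom}
      (fun s : σ → ℂˣ => Θ.θ.map fun k => s (r k)) := by
  have := (_root_.isMorphismOn_reindex r).comp Θ.θ.morphism
  rw [Set.univ_inter] at this
  exact this

lemma IsMorphismOn.mono_torus {Y : IndSpace.{v}} {U : Set (σ → ℂˣ)} {f : (σ → ℂˣ) → Y.carrier}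
    (hf : IsMorphismOn (torus σ) Y Set.univ f) (hU : IsOpen[zar σ] U) :
    IsMorphismOn (torus σ) Y U f :=
  hf.mono (Set.subset_univ _) (torus_top (σ := σ) ▸ hU)

lemma TorusChart.isMorphismOn_pair (a : σ) (r : ι → σ) :
    IsMorphismOn (torus σ) (Gm.prod X) {s : σ → ℂˣ | (fun k => s (r k)) ∈ Θ.θ.dom}
      (fun s : σ → ℂˣ => (s a, Θ.θ.map fun k => s (r k))) :=
  IsMorphismOn.pair (Θ.isOpen_dom r) ((isMorphismOn_coord a).mono_torus (Θ.isOpen_dom r))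
    (Θ.isMorphismOn_reindex r)

lemma TorusChart.isMorphismOn_pair_pair (a b : σ) (r : ι → σ) :
    IsMorphismOn (torus σ) (Gm.prod (Gm.prod X)) {s : σ → ℂˣ | (fun k => s (r k)) ∈ Θ.θ.dom}
      (fun s : σ → ℂˣ => (s a, s b, Θ.θ.map fun k => s (r k))) :=
  IsMorphismOn.pair (Θ.isOpen_dom r) ((isMorphismOn_coord a).mono_torus (Θ.isOpen_dom r))
    (Θ.isMorphismOn_pair b r)

lemma TorusChart.isMorphismOn_torus_pair (q : κ → σ) (r : ι → σ) :
    IsMorphismOn (torus σ) ((torus κ).prod X) {s : σ → ℂˣ | (fun k => s (r k)) ∈ Θ.θ.dom}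
      (fun s : σ → ℂˣ => (fun k => s (q k), Θ.θ.map fun k => s (r k))) :=
  IsMorphismOn.pair (Θ.isOpen_dom r)
    ((_root_.isMorphismOn_reindex q).mono_torus (Θ.isOpen_dom r)) (Θ.isMorphismOn_reindex r)

lemma isOpen_preimage_torus {Y : IndSpace.{v}} {U : Set (σ → ℂˣ)} {f : (σ → ℂˣ) → Y.carrier}
    (hf : IsMorphismOn (torus σ) Y U f) {O : Set Y.carrier} (hO : IsOpen[Y.top] O) :
    IsOpen[zar σ] {s | s ∈ U ∧ f s ∈ O} := by
  have := hf.isOpen_preimage hO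
  rw [torus_top] at this
  exact this

end Charts

/-! ### Generic conditions seen through a chart -/

section Generic

variable {ι σ κ : Type} [Fintype ι] [Fintype σ] [Fintype κ] {X : IndSpace.{u}} (Θ : TorusChart ι X)

/-- A generic point of `T'` is mapped into a given open dense subset of `X`. -/
lemma TorusChart.isOpen_and_nonempty {ι : Type} (Θ : TorusChart ι X) {O : Set X.carrier} (hO : X.OpenDense O) :
    IsOpen[zar ι] {t | t ∈ Θ.θ.dom ∧ Θ.θ.map t ∈ O} ∧
      {t | t ∈ Θ.θ.dom ∧ Θ.θ.map t ∈ O}.Nonempty := by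
  refine ⟨isOpen_preimage_torus Θ.θ.morphism hO.1, ?_⟩
  obtain ⟨W, hW, hWr⟩ := Θ.exists_right_inv
  have := Θ.carrier_nonempty
  obtain ⟨x, hx, hx'⟩ := (hO.inter hW).nonempty
  obtain ⟨-, h2, h3⟩ := hWr hx'
  -- Nonemptiness comes from a point of the given set at which `θ ∘ θ⁻¹` is the identity.
  exact ⟨Θ.inv.map x, h2, by rw [h3]; exact hx⟩

/-- The slice over the locus `θ ∘ θ⁻¹ = id` is open, so it meets the dense set `W`. A common point
`(c, x)` lifts to `(c, θ⁻¹ x)`, which shows that the open preimage of `W` in the torus is nonempty.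
-/
lemma TorusChart.residual_pair (hX : ∀ n, (X.sp n).HasOne) {W : Set (ℂˣ × X.carrier)}
    (hW : (Gm.prod X).OpenDense W) :
    ∀ᶠ v in residual (Option ι → ℝ), (expUnit (v none), Θ.θ.map (expPoint fun k => v (some k))) ∈ W := by
  obtain ⟨R, hR, hRr⟩ := Θ.exists_right_inv
  have := Θ.carrier_nonempty
  obtain ⟨x, hx⟩ := hR.nonempty
  obtain ⟨⟨c, x⟩, hxR, hxW⟩ := hW.inter_open_nonempty
    (IndSpace.isOpen_snd (FunSpace.hasOne_ofAlgebra _) hX hR.1) ⟨((1 : ℂˣ), x), hx⟩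
  obtain ⟨-, h2, h3⟩ := hRr hxR
  have := residual_of_zar (isOpen_preimage_torus (Θ.isMorphismOn_pair (none : Option ι) some) hW.1)
    ⟨fun k => k.elim c (Θ.inv.map x), h2, by
      show (c, Θ.θ.map (Θ.inv.map x)) ∈ W
      rw [h3]; exact hxW⟩
  filter_upwards [this] with v hv
  exact hv.2

lemma TorusChart.residual_pair_pair (hX : ∀ n, (X.sp n).HasOne) {W : Set (ℂˣ × ℂˣ × X.carrier)}
    (hW : (Gm.prod (Gm.prod X)).OpenDense W) :
    ∀ᶠ v in residual (Option (Option ι) → ℝ), (expUnit (v none), expUnit (v (some none)),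
      Θ.θ.map (expPoint fun k => v (some (some k)))) ∈ W := by
  obtain ⟨R, hR, hRr⟩ := Θ.exists_right_inv
  have := Θ.carrier_nonempty
  obtain ⟨x, hx⟩ := hR.nonempty
  obtain ⟨⟨c, c', x⟩, hxR, hxW⟩ := hW.inter_open_nonempty
    (IndSpace.isOpen_snd (FunSpace.hasOne_ofAlgebra _)
      (fun n => FunSpace.HasOne.prod (Gm_hasOne n) (hX n))
      (IndSpace.isOpen_snd (FunSpace.hasOne_ofAlgebra _) hX hR.1))
    ⟨((1 : ℂˣ), (1 : ℂˣ), x), hx⟩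
  obtain ⟨-, h2, h3⟩ := hRr hxR
  have := residual_of_zar (isOpen_preimage_torus
    (Θ.isMorphismOn_pair_pair (none : Option (Option ι)) (some none) fun k => some (some k)) hW.1)
    ⟨fun k => k.elim c fun k => k.elim c' (Θ.inv.map x), h2, by
      show (c, c', Θ.θ.map (Θ.inv.map x)) ∈ W
      rw [h3]; exact hxW⟩
  filter_upwards [this] with v hv
  exact hv.2

lemma TorusChart.residual_torus_pair (hX : ∀ n, (X.sp n).HasOne)
    {W : Set ((κ → ℂˣ) × X.carrier)} (hW : ((torus κ).prod X).OpenDense W) :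
    ∀ᶠ z in residual (κ ⊕ ι → ℝ), ((expPoint fun k => z (Sum.inl k)),
      Θ.θ.map (expPoint fun k => z (Sum.inr k))) ∈ W := by
  obtain ⟨R, hR, hRr⟩ := Θ.exists_right_inv
  have := Θ.carrier_nonempty
  obtain ⟨x, hx⟩ := hR.nonempty
  obtain ⟨⟨t, x⟩, hxR, hxW⟩ := hW.inter_open_nonempty
    (IndSpace.isOpen_snd (FunSpace.hasOne_ofAlgebra _) hX hR.1) ⟨((1 : κ → ℂˣ), x), hx⟩
  obtain ⟨-, h2, h3⟩ := hRr hxR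
  have := residual_of_zar (isOpen_preimage_torus
    (Θ.isMorphismOn_torus_pair (Sum.inl : κ → κ ⊕ ι) Sum.inr) hW.1)
    ⟨Sum.elim t (Θ.inv.map x), h2, by
      show (t, Θ.θ.map (Θ.inv.map x)) ∈ W
      rw [h3]; exact hxW⟩
  filter_upwards [this] with v hv
  exact hv.2

/-- Turns an identity of rational maps, known only generically, into one valid at every real vector,
including those on integral rays. -/
lemma eq_of_residual {X Y : Type*} [TopologicalSpace X] [BaireSpace X] [TopologicalSpace Y]
    [T2Space Y] {f g : X → Y} (hf : Continuous f) (hg : Continuous g)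
    (h : ∀ᶠ x in residual X, f x = g x) : f = g :=
  Continuous.ext_on (dense_of_mem_residual h) hf hg fun _ hx => hx

lemma tendsto_residual_linear {τ : Type} [Fintype τ] (L : (σ → ℝ) →ₗ[ℝ] (τ → ℝ))
    (hL : Function.Surjective L) : Filter.Tendsto L (residual (σ → ℝ)) (residual (τ → ℝ)) :=
  tendsto_residual_of_isOpenMap L.continuous_of_finiteDimensional
    (L.isOpenMap_of_finiteDimensional hL)

lemma tendsto_residual_reindex {τ : Type} [Fintype τ] {r : τ → σ} (hr : Function.Injective r) :
    Filter.Tendsto (fun (v : σ → ℝ) k => v (r k)) (residual (σ → ℝ)) (residual (τ → ℝ)) :=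
  tendsto_residual_linear (LinearMap.funLeft ℝ ℝ r) (LinearMap.funLeft_surjective_of_injective ℝ ℝ r hr)

end Generic

/-! ### Real flows and the homeomorphisms attached to words -/

section Flows

variable {I κ ι : Type} [Fintype I] [DecidableEq I] [Fintype κ] [Fintype ι] {A : Matrix I I ℤ}

/-- The vector with first coordinate `a` and remaining coordinates `u`. -/
def consVec {R : Type*} (a : R) (u : ι → R) : Option ι → R := fun k => k.elim a u

/-- A continuous action of the additive group `ℝ` on `ℝ^ι`. -/
structure IsFlow (E : (Option ι → ℝ) → ι → ℝ) : Prop where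
  continuous : Continuous E
  zero : ∀ u, E (consVec 0 u) = u
  add : ∀ a b u, E (consVec a (E (consVec b u))) = E (consVec (a + b) u)

lemma continuous_consVec {ι : Type} {Z : Type*} [TopologicalSpace Z] {a : Z → ℝ} {u : Z → ι → ℝ}
    (ha : Continuous a) (hu : Continuous u) : Continuous fun z => consVec (a z) (u z) :=
  continuous_pi fun k => by
    cases k with
    | none => exact ha
    | some k => exact (continuous_apply k).comp hu

/-- The homeomorphism `(t, u) ↦ (t, E (μ t, u))` for a linear form `μ`. -/
def IsFlow.shear {E : (Option ι → ℝ) → ι → ℝ} (hE : IsFlow E) (μ : κ → ℤ) :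
    (κ ⊕ ι → ℝ) ≃ₜ (κ ⊕ ι → ℝ) where
  toFun z := Sum.elim (fun k => z (Sum.inl k))
    (E (consVec (∑ k, μ k * z (Sum.inl k)) fun k => z (Sum.inr k)))
  invFun z := Sum.elim (fun k => z (Sum.inl k))
    (E (consVec (-∑ k, μ k * z (Sum.inl k)) fun k => z (Sum.inr k)))
  left_inv z := by
    funext k
    cases k with
    | inl k => rfl
    | inr k =>
      simp only [Sum.elim_inl, Sum.elim_inr]
      rw [hE.add, neg_add_cancel, hE.zero]
  right_inv z := by
    funext k
    cases k with
    | inl k => rfl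
    | inr k =>
      simp only [Sum.elim_inl, Sum.elim_inr]
      rw [hE.add, add_neg_cancel, hE.zero]
  continuous_toFun := continuous_pi fun k => by
    cases k with
    | inl k => exact continuous_apply _
    | inr k =>
      exact (continuous_apply k).comp (hE.continuous.comp
        (continuous_consVec (by fun_prop) (by fun_prop)))
  continuous_invFun := continuous_pi fun k => by
    cases k with
    | inl k => exact continuous_apply _
    | inr k =>
      exact (continuous_apply k).comp (hE.continuous.comp
        (continuous_consVec (by fun_prop) (by fun_prop)))

lemma tendsto_residual_homeo {X Y : Type*} [TopologicalSpace X] [TopologicalSpace Y] (h : X ≃ₜ Y) :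
    Filter.Tendsto h (residual X) (residual Y) :=
  tendsto_residual_of_isOpenMap h.continuous h.isOpenMap

lemma consVec_eta {ι : Type} {R : Type*} (v : Option ι → R) : consVec (v none) (fun k => v (some k)) = v := by
  funext k
  cases k <;> rfl

/-- The map `(t, u) ↦ (μ t, u)` for a nonzero linear form `μ`. -/
lemma tendsto_residual_char {μ : κ → ℤ} (hμ : μ ≠ 0) :
    Filter.Tendsto (fun z : κ ⊕ ι → ℝ => consVec (∑ k, μ k * z (Sum.inl k)) fun k => z (Sum.inr k))
      (residual (κ ⊕ ι → ℝ)) (residual (Option ι → ℝ)) := by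
  classical
  let L : (κ ⊕ ι → ℝ) →ₗ[ℝ] (Option ι → ℝ) :=
    { toFun := fun z => consVec (∑ k, μ k * z (Sum.inl k)) fun k => z (Sum.inr k)
      map_add' := fun x y => by
        funext k
        cases k with
        | none => simp [consVec, mul_add, Finset.sum_add_distrib]
        | some k => rfl
      map_smul' := fun c x => by
        funext k
        cases k with
        | none => simp [consVec, Finset.mul_sum, mul_left_comm]
        | some k => rfl }
  refine tendsto_residual_linear L fun v => ?_
  obtain ⟨k₀, hk₀⟩ := Function.ne_iff.1 hμ
  have hk₀' : (μ k₀ : ℝ) ≠ 0 := by exact_mod_cast hk₀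
  refine ⟨Sum.elim (Pi.single k₀ (v none / μ k₀)) fun k => v (some k), ?_⟩
  funext k
  cases k with
  | none =>
    show ∑ k, (μ k : ℝ) * (Pi.single k₀ (v none / (μ k₀ : ℝ)) : κ → ℝ) k = v none
    rw [Finset.sum_eq_single k₀ (fun j _ hj => by simp [hj]) (by simp), Pi.single_eq_same,
      mul_div_cancel₀ _ hk₀']
  | some k => rfl

/-- A flow map is a shear homeomorphism followed by a coordinate projection, hence pulls residual
sets back to residual sets. -/
lemma IsFlow.tendsto_residual {E : (Option ι → ℝ) → ι → ℝ} (hE : IsFlow E) :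
    Filter.Tendsto E (residual (Option ι → ℝ)) (residual (ι → ℝ)) := by
  have h1 : Filter.Tendsto (fun (v : Option ι → ℝ) (k : Unit ⊕ ι) =>
      v (k.elim (fun _ => none) some)) (residual _) (residual _) := by
    refine tendsto_residual_reindex fun a b h => ?_
    rcases a with _ | a <;> rcases b with _ | b <;> simp_all
  have h2 := tendsto_residual_homeo (hE.shear (κ := Unit) 1)
  have h3 : Filter.Tendsto (fun (z : Unit ⊕ ι → ℝ) k => z (Sum.inr k)) (residual _) (residual _) :=
    tendsto_residual_reindex Sum.inr_injective
  refine (h3.comp (h2.comp h1)).congr fun v => ?_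
  funext k
  show E (consVec (∑ k : Unit, ((1 : Unit → ℤ) k : ℝ) * v none) fun k => v (some k)) k = E v k
  simp [consVec_eta]

/-- The homeomorphism `(t, u) ↦ (t, E_{i_1}^{α^{(1)}(t)} ⋯ E_{i_l}^{α^{(l)}(t)} (u))`. -/
def wordFlow (D : TorusDatum A κ) {E : I → (Option ι → ℝ) → ι → ℝ} (hE : ∀ i, IsFlow (E i)) :
    List I → (κ ⊕ ι → ℝ) ≃ₜ (κ ⊕ ι → ℝ)
  | [] => Homeomorph.refl _
  | i :: w => (wordFlow D hE w).trans ((hE i).shear (D.char (wordRoot A i w)))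

lemma wordFlow_inl {ι : Type} (D : TorusDatum A κ) {E : I → (Option ι → ℝ) → ι → ℝ} (hE : ∀ i, IsFlow (E i))
    (w : List I) (z : κ ⊕ ι → ℝ) (k : κ) : wordFlow D hE w z (Sum.inl k) = z (Sum.inl k) := by
  induction w with
  | nil => rfl
  | cons i w ih => exact ih

lemma wordFlow_cons_inr {ι : Type} (D : TorusDatum A κ) {E : I → (Option ι → ℝ) → ι → ℝ}
    (hE : ∀ i, IsFlow (E i)) (i : I) (w : List I) (z : κ ⊕ ι → ℝ) :
    (fun k => wordFlow D hE (i :: w) z (Sum.inr k)) =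
      E i (consVec (∑ k, D.char (wordRoot A i w) k * z (Sum.inl k))
        fun k => wordFlow D hE w z (Sum.inr k)) := by
  have h : (∑ k, (D.char (wordRoot A i w) k : ℝ) * wordFlow D hE w z (Sum.inl k)) =
      ∑ k, (D.char (wordRoot A i w) k : ℝ) * z (Sum.inl k) := by
    simp only [wordFlow_inl]
  rw [← h]
  rfl

end Flows

/-! ### The roots of a word are nontrivial characters -/

section Roots

variable {I κ : Type} [Fintype I] [DecidableEq I] [Fintype κ] {A : Matrix I I ℤ}

lemma TorusDatum.sum_eq_zero {I : Type} [Fintype I] {A : Matrix I I ℤ} (D : TorusDatum A κ) {β : I → ℤ} (h : D.char β = 0) (i : I) :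
    ∑ j, A i j * β j = 0 := by
  have h1 : charPairing (D.char β) (D.coroot i) = 0 := by simp [h, charPairing]
  rw [← h1]
  simp only [charPairing, TorusDatum.char, Finset.sum_mul]
  rw [Finset.sum_comm]
  refine Finset.sum_congr rfl fun j _ => ?_
  rw [← D.pairing i j, charPairing, Finset.sum_mul]
  exact Finset.sum_congr rfl fun k _ => by ring

lemma simpleRefl_apply (A : Matrix I I ℤ) (i : I) (β : I → ℤ) :
    simpleRefl A i β = β - Pi.single i (∑ j, A i j * β j) := rfl

lemma simpleRefl_simpleRefl (hA : ∀ i, A i i = 2) (i : I) (β : I → ℤ) :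
    simpleRefl A i (simpleRefl A i β) = β := by
  have h : ∑ j, A i j * (simpleRefl A i β) j = -∑ j, A i j * β j := by
    simp only [simpleRefl_apply, Pi.sub_apply, mul_sub, Finset.sum_sub_distrib]
    rw [Finset.sum_eq_single (a := i) (f := fun j => A i j * (Pi.single i _ : I → ℤ) j)
      (fun j _ hj => by simp [hj]) (by simp), Pi.single_eq_same, hA]
    ring
  rw [simpleRefl_apply A i (simpleRefl A i β), h, simpleRefl_apply, Pi.single_neg]
  abel

lemma wordProd_injective (hA : ∀ i, A i i = 2) (w : List I) :
    Function.Injective (wordProd A w) := by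
  induction w with
  | nil => exact fun _ _ h => h
  | cons i w ih =>
    have : ∀ β, wordProd A (i :: w) β = simpleRefl A i (wordProd A w β) := fun β => by
      simp [wordProd]
    intro β γ h
    rw [this, this] at h
    exact ih ((Function.LeftInverse.injective (simpleRefl_simpleRefl hA i)) h)

lemma wordProd_fixed {β : I → ℤ} (hβ : ∀ i, ∑ j, A i j * β j = 0) (w : List I) :
    wordProd A w β = β := by
  induction w with
  | nil => rfl
  | cons i w ih =>
    have : wordProd A (i :: w) β = simpleRefl A i (wordProd A w β) := by simp [wordProd]
    rw [this, ih, simpleRefl_apply, hβ, Pi.single_zero, sub_zero]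

/-- A root that is trivial on `T` pairs to zero with all co-roots, so every simple reflection fixes
it. Undoing the word then identifies it with `α_i`, contrary to `a_ii = 2`. Nontriviality makes `(t,
u) ↦ (α(t), u)` surjective in logarithmic coordinates. -/
lemma TorusDatum.char_wordRoot_ne_zero (D : TorusDatum A κ) (hA : ∀ i, A i i = 2) (i : I)
    (w : List I) : D.char (wordRoot A i w) ≠ 0 := by
  intro h
  have h0 := D.sum_eq_zero h
  have h1 : wordRoot A i w = Pi.single i 1 :=
    wordProd_injective hA w.reverse ((wordProd_fixed h0 _).trans rfl)
  have h2 := h0 i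
  rw [h1, Finset.sum_eq_single i (fun j _ hj => by simp [hj]) (by simp), Pi.single_eq_same, hA] at h2
  omega

end Roots

/-! ### Crystal relations on real vectors and on the lattice -/

section Action

variable {I κ ι : Type} [Fintype I] [DecidableEq I] [Fintype κ] [Fintype ι] {A : Matrix I I ℤ}
  {D : TorusDatum A κ} (χ : GeometricCrystal.{u} D) (Θ : TorusChart ι χ.X)

lemma GeometricCrystal.hasOne (n : ℕ) : (χ.X.sp n).HasOne := (χ.indVariety.1 n).hasOne

/-- `E` describes the action of `e_i` on the positive point `v` of `ℂˣ × T'`. -/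
structure ActsAt (i : I) (E : (Option ι → ℝ) → ι → ℝ) (v : Option ι → ℝ) : Prop where
  mem_dom : expPoint (fun k => v (some k)) ∈ Θ.θ.dom
  mem_act : (expUnit (v none), Θ.θ.map (expPoint fun k => v (some k))) ∈ (χ.e i).dom
  inv_map : Θ.inv.map ((χ.e i).map (expUnit (v none), Θ.θ.map (expPoint fun k => v (some k)))) =
    expPoint (E v)
  mem_dom' : expPoint (E v) ∈ Θ.θ.dom
  map_eq : Θ.θ.map (expPoint (E v)) =
    (χ.e i).map (expUnit (v none), Θ.θ.map (expPoint fun k => v (some k)))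

lemma isMorphismOn_act {ι σ : Type} (Θ : TorusChart ι χ.X) (i : I) (a : σ) (r : ι → σ) :
    IsMorphismOn (torus σ) χ.X {s : σ → ℂˣ | (fun k => s (r k)) ∈ Θ.θ.dom ∧
      (s a, Θ.θ.map fun k => s (r k)) ∈ (χ.e i).dom}
      (fun s : σ → ℂˣ => (χ.e i).map (s a, Θ.θ.map fun k => s (r k))) :=
  (Θ.isMorphismOn_pair a r).comp (χ.e i).morphism

lemma exists_map_one (i : I) : ∃ W, χ.X.OpenDense W ∧
    ∀ x ∈ W, ((1 : ℂˣ), x) ∈ (χ.e i).dom ∧ (χ.e i).map ((1 : ℂˣ), x) = x := by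
  obtain ⟨W, hW, h⟩ := χ.e_one i
  refine ⟨W, hW, fun x hx => ?_⟩
  obtain ⟨z, hz, hz'⟩ := h x hx
  obtain rfl := (Part.mem_some_iff.1 hz')
  exact RatMor.mem_part.1 hz

/-- Besides the formula for `e_{i,θ}`, the point `e_i^c (θ t)` must lie where `θ ∘ θ⁻¹` is the
identity; only then can the result be fed into a further map on `X`. -/
lemma exists_actsAt (i : I) {E : (Option ι → ℝ) → ι → ℝ} (hE : IsLogMap (eTheta χ Θ i) E) :
    ∃ W, IsOpen[zar (Option ι)] W ∧ W.Nonempty ∧ ∀ v, expPoint v ∈ W → ActsAt χ Θ i E v := by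
  obtain ⟨W, hW, hWne, h⟩ := hE.generic
  obtain ⟨R, hR, hRr⟩ := Θ.exists_right_inv
  obtain ⟨W₁, hW₁, h₁⟩ := exists_map_one χ i
  have ho := isOpen_preimage_torus (isMorphismOn_act χ Θ i (none : Option ι) some) hR.1
  refine ⟨_, isOpen_inter_of hW ho, zar_inter_nonempty hW ho hWne ?_, ?_⟩
  -- At `c = 1` the action is generically the identity, so the extra condition already holds at some
  -- point `(1, t)`.
  · obtain ⟨t, ht, htR, ht₁⟩ := (Θ.isOpen_and_nonempty (hR.inter hW₁)).2
    obtain ⟨h2, h3⟩ := h₁ _ ht₁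
    refine ⟨consVec 1 t, ⟨ht, h2⟩, ?_⟩
    show (χ.e i).map ((1 : ℂˣ), Θ.θ.map t) ∈ R
    rw [h3]; exact htR
  · rintro v ⟨hv, ⟨h2, h3⟩, h4⟩
    obtain ⟨y, hy, hy'⟩ := Part.mem_bind_iff.1 (h v hv)
    obtain ⟨x, hx, hx'⟩ := Part.mem_bind_iff.1 hy
    obtain ⟨-, rfl⟩ := RatMor.mem_part.1 hx
    obtain ⟨-, rfl⟩ := RatMor.mem_part.1 hx'
    obtain ⟨-, hinv⟩ := RatMor.mem_part.1 hy'
    obtain ⟨-, h6, h7⟩ := hRr h4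
    have hinv' : Θ.inv.map ((χ.e i).map
      (expUnit (v none), Θ.θ.map (expPoint fun k => v (some k)))) = expPoint (E v) := hinv
    have h6' : Θ.inv.map ((χ.e i).map
      (expUnit (v none), Θ.θ.map (expPoint fun k => v (some k)))) ∈ Θ.θ.dom := h6
    have h7' : Θ.θ.map (Θ.inv.map ((χ.e i).map
      (expUnit (v none), Θ.θ.map (expPoint fun k => v (some k))))) = _ := h7
    rw [hinv'] at h6' h7'
    exact ⟨h2, h3, hinv', h6', h7'⟩

lemma residual_actsAt (i : I) {E : (Option ι → ℝ) → ι → ℝ} (hE : IsLogMap (eTheta χ Θ i) E) :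
    ∀ᶠ v in residual (Option ι → ℝ), ActsAt χ Θ i E v := by
  obtain ⟨W, hW, hWne, h⟩ := exists_actsAt χ Θ i hE
  filter_upwards [residual_of_zar hW hWne] with v hv using h v hv

/-- The rational map `(c₁, c₂, t) ↦ (c₁, e_{i,θ} (c₂, t))` is dominant. -/
lemma residual_dominant (i : I) {E : (Option ι → ℝ) → ι → ℝ} (hE : IsLogMap (eTheta χ Θ i) E)
    {O : Set (Option ι → ℂˣ)} (hO : IsOpen[zar (Option ι)] O) (hne : O.Nonempty) :
    ∀ᶠ v in residual (Option (Option ι) → ℝ), expPoint (consVec (v none) (E fun k => v (some k))) ∈ O := by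
  have hm := (isMorphismOn_act χ Θ i (some none : Option (Option ι)) fun k => some (some k)).comp
    Θ.inv.morphism
  have hU := isOpen_preimage_torus
    (isMorphismOn_act χ Θ i (some none : Option (Option ι)) fun k => some (some k))
    Θ.inv.openDense.1
  have ho := isOpen_preimage_of_regAt (τ := Option ι) hU
    (F := fun s => consVec (s none) (Θ.inv.map ((χ.e i).map (s (some none),
      Θ.θ.map fun k => s (some (some k)))))) (fun s hs k => by
        cases k with
        | none => exact FunSpace.regAt_of_mem (torusAlgebra_coord none) s
        | some k => exact hm.regAt_coord hs k) hO
  refine ((residual_of_zar ho ?_).and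
    ((tendsto_residual_reindex (Option.some_injective (Option ι))).eventually
      (residual_actsAt χ Θ i hE))).mono ?_
  -- Nonemptiness of the preimage: with `c₂ = 1` the map is the identity in `(c₁, t)` for generic
  -- `t`, and `O` contains a point with such a `t`.
  · obtain ⟨W₁, hW₁, h₁⟩ := exists_map_one χ i
    obtain ⟨V, hV, hVne, hVi⟩ := Θ.exists_left_inv
    obtain ⟨hV', hVne'⟩ := Θ.isOpen_and_nonempty hW₁
    obtain ⟨t, htV, htV'⟩ := zar_inter_nonempty hV hV' hVne hVne'
    have hpre := isOpen_preimage_torus (isMorphismOn_reindex (some : ι → Option ι))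
      (O := V ∩ {t | t ∈ Θ.θ.dom ∧ Θ.θ.map t ∈ W₁}) (torus_top ▸ isOpen_inter_of hV hV')
    obtain ⟨s, ⟨-, hsV, hsd, hs₁⟩, hsO⟩ :=
      zar_inter_nonempty hpre hO ⟨consVec 1 t, trivial, htV, htV'⟩ hne
    obtain ⟨h2, h3⟩ := h₁ _ hs₁
    obtain ⟨-, h5, h6⟩ := hVi _ hsV
    have h3' : (χ.e i).map ((1 : ℂˣ), Θ.θ.map fun k => s (some k)) =
      Θ.θ.map fun k => s (some k) := h3
    refine ⟨consVec (s none) (consVec 1 fun k => s (some k)), ⟨⟨hsd, h2⟩, ?_⟩, ?_⟩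
    · show (χ.e i).map ((1 : ℂˣ), Θ.θ.map fun k => s (some k)) ∈ Θ.inv.dom
      rw [h3']; exact h5
    · show consVec (s none) (Θ.inv.map
        ((χ.e i).map ((1 : ℂˣ), Θ.θ.map fun k => s (some k)))) ∈ O
      rw [h3', h6, consVec_eta]
      exact hsO
  · rintro v ⟨hv, hact⟩
    have h1 : consVec (expUnit (v none)) (Θ.inv.map ((χ.e i).map (expUnit (v (some none)),
      Θ.θ.map (expPoint fun k => v (some (some k)))))) ∈ O := hv.2
    have h2 : Θ.inv.map ((χ.e i).map (expUnit (v (some none)),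
      Θ.θ.map (expPoint fun k => v (some (some k))))) = expPoint (E fun k => v (some k)) :=
      hact.inv_map
    have h3 : expPoint (consVec (v none) (E fun k => v (some k))) =
        consVec (expUnit (v none)) (expPoint (E fun k => v (some k))) := by
      funext k
      cases k <;> rfl
    rw [h3, ← h2]
    exact h1

/-- `E` is not yet known to be a flow, so the outer application is shown to be generic by the
algebraic dominance of `residual_dominant`. The identity then spreads from a residual set by
continuity. -/
lemma act_add (i : I) {E : (Option ι → ℝ) → ι → ℝ} (hE : IsLogMap (eTheta χ Θ i) E) (a b : ℝ)
    (u : ι → ℝ) : E (consVec a (E (consVec b u))) = E (consVec (a + b) u) := by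
  let L : (Option (Option ι) → ℝ) →ₗ[ℝ] (Option ι → ℝ) :=
    { toFun := fun v => consVec (v none + v (some none)) fun k => v (some (some k))
      map_add' := fun x y => by
        funext k
        cases k with
        | none => exact add_add_add_comm _ _ _ _
        | some k => rfl
      map_smul' := fun c x => by
        funext k
        cases k with
        | none => exact (mul_add _ _ _).symm
        | some k => rfl }
  have hL : Function.Surjective L := fun v => by
    refine ⟨consVec 0 v, ?_⟩
    show consVec (0 + v none) (fun k => v (some k)) = v
    rw [zero_add, consVec_eta]
  obtain ⟨W, hW, hWe⟩ := χ.e_mul i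
  obtain ⟨G, hG, hGne, hGa⟩ := exists_actsAt χ Θ i hE
  have key : (fun v : Option (Option ι) → ℝ => E (consVec (v none) (E fun k => v (some k)))) =
      fun v => E (L v) := by
    refine eq_of_residual (hE.continuous.comp (continuous_consVec (continuous_apply _)
      (hE.continuous.comp (by fun_prop))))
      (hE.continuous.comp L.continuous_of_finiteDimensional) ?_
    filter_upwards [Θ.residual_pair_pair χ.hasOne hW, residual_dominant χ Θ i hE hG hGne,
      (tendsto_residual_reindex (Option.some_injective (Option ι))).eventually
        (residual_actsAt χ Θ i hE),
      (tendsto_residual_linear L hL).eventually (residual_actsAt χ Θ i hE)] with v h1 h2 h3 h4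
    have h2 := hGa _ h2
    obtain ⟨z, hz, hz'⟩ := hWe _ h1
    obtain ⟨y, hy, hy'⟩ := Part.mem_bind_iff.1 hz
    obtain ⟨-, hy⟩ := RatMor.mem_part.1 hy
    obtain ⟨-, hy'⟩ := RatMor.mem_part.1 hy'
    obtain ⟨-, hz'⟩ := RatMor.mem_part.1 hz'
    have e3 := h3.map_eq.trans hy
    have e2 : Θ.inv.map ((χ.e i).map (expUnit (v none), Θ.θ.map (expPoint (E fun k => v (some k))))) =
      expPoint (E (consVec (v none) (E fun k => v (some k)))) := h2.inv_map
    have e4 : Θ.inv.map ((χ.e i).map (expUnit (v none + v (some none)),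
      Θ.θ.map (expPoint fun k => v (some (some k))))) = expPoint (E (L v)) := h4.inv_map
    rw [expUnit_add] at e4
    have hy'' : (χ.e i).map (expUnit (v none), y) = z := hy'
    have hz'' : (χ.e i).map (expUnit (v none) * expUnit (v (some none)),
      Θ.θ.map (expPoint fun k => v (some (some k)))) = z := hz'
    rw [e3, hy''] at e2
    rw [hz''] at e4
    exact expPoint_injective (e2.symm.trans e4)
  exact congrFun key (consVec a (consVec b u))

/-- The hyperplane `c = 1` may miss the open set where `E` represents `e_{i,θ}`, so the axiom `e_i^1
= id` is not applied directly. By `act_add`, `E (0, ·)` fixes every value of `E`. If it moved some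
point, then by rationality it would move a nonempty Zariski open set of points, which by dominance
contains a value of `E`. -/
lemma act_zero (i : I) {E : (Option ι → ℝ) → ι → ℝ} (hE : IsLogMap (eTheta χ Θ i) E)
    (u : ι → ℝ) : E (consVec 0 u) = u := by
  by_contra hne
  obtain ⟨k, hk⟩ := Function.ne_iff.1 hne
  obtain ⟨P, Q, hPQ⟩ := hE.rational k
  have hval : ∀ u : ι → ℝ, (fun j => (expPoint (consVec 0 u) j : ℂ)) =
      fun j => ((consVec (1 : ℂˣ) (expPoint u) j : ℂˣ) : ℂ) := fun u => by
    funext j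
    cases j with
    | none => simp [expPoint, consVec]
    | some j => rfl
  have hmem : ∀ p : MvPolynomial (Option ι) ℂ, (fun s : Option ι → ℂˣ => MvPolynomial.eval
      (fun j => ((consVec (1 : ℂˣ) (fun k => s (some k)) j : ℂˣ) : ℂ)) p) ∈
      torusAlgebra (Option ι) := fun p =>
    eval_mem_subalgebra (F := fun (s : Option ι → ℂˣ) j =>
      ((consVec (1 : ℂˣ) (fun k => s (some k)) j : ℂˣ) : ℂ)) (fun j => by
        cases j with
        | none => exact (torusAlgebra (Option ι)).algebraMap_mem 1
        | some j => exact torusAlgebra_coord (some j)) p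
  -- The first coordinate is replaced by `1` inside the polynomials, so the condition does not
  -- involve it and only the component `E` of the dominant map matters.
  have hO : IsOpen[zar (Option ι)] {s : Option ι → ℂˣ |
      MvPolynomial.eval (fun j => ((consVec (1 : ℂˣ) (fun k => s (some k)) j : ℂˣ) : ℂ)) P -
      s (some k) * MvPolynomial.eval
        (fun j => ((consVec (1 : ℂˣ) (fun k => s (some k)) j : ℂˣ) : ℂ)) Q ≠ 0} :=
    TopologicalSpace.isOpen_generateFrom_of_mem
      ⟨_, sub_mem (hmem P) (mul_mem (torusAlgebra_coord (some k)) (hmem Q)), rfl⟩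
  have hiff : ∀ (u : ι → ℝ),
      MvPolynomial.eval (fun j => ((consVec (1 : ℂˣ) (expPoint u) j : ℂˣ) : ℂ)) P -
      expPoint u k * MvPolynomial.eval
        (fun j => ((consVec (1 : ℂˣ) (expPoint u) j : ℂˣ) : ℂ)) Q ≠ 0 ↔
      E (consVec 0 u) k ≠ u k := by
    intro u
    obtain ⟨h1, h2⟩ := hPQ (consVec 0 u)
    rw [hval] at h1 h2
    rw [← h2, ← sub_mul, mul_ne_zero_iff, and_iff_left h1, sub_ne_zero, expPoint, ne_eq, ne_eq,
      Units.val_inj, expUnit_injective.eq_iff]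
  obtain ⟨v, hv⟩ := residual_exists (residual_dominant χ Θ i hE hO
    ⟨expPoint (consVec 0 u), (hiff u).2 hk⟩)
  refine (hiff _).1 hv ?_
  have := act_add χ Θ i hE 0 (v (some none)) fun k => v (some (some k))
  rw [zero_add, consVec_eta (fun k => v (some k))] at this
  exact congrFun this k

lemma act_isFlow (i : I) {E : (Option ι → ℝ) → ι → ℝ} (hE : IsLogMap (eTheta χ Θ i) E) :
    IsFlow E :=
  ⟨hE.continuous, act_zero χ Θ i hE, act_add χ Θ i hE⟩

lemma gamma_act (i : I) {E : (Option ι → ℝ) → ι → ℝ} (hE : IsLogMap (eTheta χ Θ i) E)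
    {G : (ι → ℝ) → κ → ℝ} (hG : IsLogMap (gammaTheta χ Θ) G) (a : ℝ) (u : ι → ℝ) :
    G (E (consVec a u)) = fun k => D.coroot i k * a + G u k := by
  obtain ⟨W, hW, hWe⟩ := χ.γ_e i
  obtain ⟨V, hV, hVne, hVe⟩ := hG.generic
  have hVγ : ∀ u, expPoint u ∈ V → Θ.θ.map (expPoint u) ∈ χ.γ.dom ∧
      χ.γ.map (Θ.θ.map (expPoint u)) = expPoint (G u) := by
    intro u hu
    obtain ⟨x, hx, hx'⟩ := Part.mem_bind_iff.1 (hVe u hu)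
    obtain ⟨-, rfl⟩ := RatMor.mem_part.1 hx
    exact RatMor.mem_part.1 hx'
  have key : (fun v : Option ι → ℝ => G (E v)) =
      fun v k => D.coroot i k * v none + G (fun k => v (some k)) k := by
    refine eq_of_residual (hG.continuous.comp hE.continuous) (continuous_pi fun k =>
      (continuous_const.mul (continuous_apply _)).add
        ((continuous_apply k).comp (hG.continuous.comp (by fun_prop)))) ?_
    filter_upwards [Θ.residual_pair χ.hasOne hW, residual_actsAt χ Θ i hE,
      (act_isFlow χ Θ i hE).tendsto_residual.eventually (residual_of_zar hV hVne),
      (tendsto_residual_reindex (Option.some_injective ι)).eventually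
        (residual_of_zar hV hVne)] with v h1 h2 h3 h4
    obtain ⟨z, hz, hz'⟩ := hWe _ h1
    obtain ⟨y, hy, hy'⟩ := Part.mem_bind_iff.1 hz
    obtain ⟨-, rfl⟩ := RatMor.mem_part.1 hy
    obtain ⟨-, hy'⟩ := RatMor.mem_part.1 hy'
    have hy2 : χ.γ.map ((χ.e i).map
      (expUnit (v none), Θ.θ.map (expPoint fun k => v (some k)))) = z := hy'
    have hy3 := (congrArg χ.γ.map h2.map_eq).trans hy2
    rw [(hVγ _ h3).2] at hy3
    obtain ⟨w, hw, hw'⟩ := (Part.mem_map_iff _).1 hz'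
    obtain ⟨-, hw⟩ := RatMor.mem_part.1 hw
    have hw2 : χ.γ.map (Θ.θ.map (expPoint fun k => v (some k))) = w := hw
    rw [(hVγ _ h4).2] at hw2
    rw [← hw2, ← hy3] at hw'
    have hw3 : torusCochar (D.coroot i) (expUnit (v none)) * expPoint (G fun k => v (some k)) =
      expPoint (G (E v)) := hw'
    apply expPoint_injective
    rw [← hw3, torusCochar_expUnit]
    funext k
    exact (expUnit_add _ _).symm
  exact congrFun key (consVec a u)

/-- When a letter is prepended, its parameter and the point reached so far depend on `z` through a
homeomorphism followed by an open linear map, so they are generic for `e_i`. -/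
lemma residual_wordMap (hA : ∀ i, A i i = 2) {E : I → (Option ι → ℝ) → ι → ℝ}
    (hE : ∀ i, IsLogMap (eTheta χ Θ i) (E i)) (hF : ∀ i, IsFlow (E i)) (w : List I) :
    ∀ᶠ z in residual (κ ⊕ ι → ℝ),
      Θ.θ.map (expPoint fun k => wordFlow D hF w z (Sum.inr k)) ∈
        wordMap D χ.X χ.e w (expPoint fun k => z (Sum.inl k),
          Θ.θ.map (expPoint fun k => z (Sum.inr k))) := by
  induction w with
  | nil => exact Filter.Eventually.of_forall fun z => Part.mem_some _
  | cons i w ih =>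
    have h := ((tendsto_residual_char (ι := ι) (D.char_wordRoot_ne_zero hA i w)).comp
      (tendsto_residual_homeo (wordFlow D hF w))).eventually (residual_actsAt χ Θ i (hE i))
    filter_upwards [ih, h] with z h1 h2
    refine Part.mem_bind_iff.2 ⟨_, h1, RatMor.mem_part.2 ?_⟩
    have hc : torusChar (D.char (wordRoot A i w)) (expPoint fun k => z (Sum.inl k)) =
        expUnit (∑ k, D.char (wordRoot A i w) k * wordFlow D hF w z (Sum.inl k)) := by
      rw [torusChar_expPoint]
      simp only [wordFlow_inl]
    show (torusChar (D.char (wordRoot A i w)) (expPoint fun k => z (Sum.inl k)),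
        Θ.θ.map (expPoint fun k => wordFlow D hF w z (Sum.inr k))) ∈ (χ.e i).dom ∧
      (χ.e i).map (torusChar (D.char (wordRoot A i w)) (expPoint fun k => z (Sum.inl k)),
        Θ.θ.map (expPoint fun k => wordFlow D hF w z (Sum.inr k))) = _
    rw [hc]
    exact ⟨h2.mem_act, h2.map_eq.symm⟩

/-- Both words lead to the same point of `X`; applying `θ⁻¹`, generically defined at the two real
images, recovers equality in coordinates. -/
lemma wordFlow_braid (hA : ∀ i, A i i = 2) {E : I → (Option ι → ℝ) → ι → ℝ}
    (hE : ∀ i, IsLogMap (eTheta χ Θ i) (E i)) (hF : ∀ i, IsFlow (E i))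
    {w : Module.End ℤ (I → ℤ)} {l l' : List I} (hl : l ∈ reducedWords A w)
    (hl' : l' ∈ reducedWords A w) (z : κ ⊕ ι → ℝ) :
    (fun k => wordFlow D hF l z (Sum.inr k)) = fun k => wordFlow D hF l' z (Sum.inr k) := by
  obtain ⟨W, hW, hWe⟩ := χ.braid w l hl l' hl'
  obtain ⟨V, hV, hVne, hVi⟩ := Θ.exists_left_inv
  have hproj : ∀ l : List I, ∀ᶠ z in residual (κ ⊕ ι → ℝ),
      (expPoint fun k => wordFlow D hF l z (Sum.inr k)) ∈ V := fun l =>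
    ((tendsto_residual_reindex Sum.inr_injective).comp
      (tendsto_residual_homeo (wordFlow D hF l))).eventually (residual_of_zar hV hVne)
  have key : (fun z => fun k => wordFlow D hF l z (Sum.inr k)) =
      fun z => fun k => wordFlow D hF l' z (Sum.inr k) := by
    refine eq_of_residual
      (continuous_pi fun k => (continuous_apply _).comp (wordFlow D hF l).continuous)
      (continuous_pi fun k => (continuous_apply _).comp (wordFlow D hF l').continuous) ?_
    filter_upwards [Θ.residual_torus_pair χ.hasOne hW, residual_wordMap χ Θ hA hE hF l,
      residual_wordMap χ Θ hA hE hF l', hproj l, hproj l'] with z h1 h2 h3 h4 h5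
    obtain ⟨y, hy, hy'⟩ := hWe _ h1
    have e := (Part.mem_unique h2 hy).trans (Part.mem_unique h3 hy').symm
    apply expPoint_injective
    rw [← (hVi _ h4).2.2, ← (hVi _ h5).2.2, e]
  exact congrFun key z

lemma Near.consVec {ι : Type} {a : ℕ → ℝ} {n : ℤ} (ha : ∀ s : ℕ, a s = s * n) {x : ℕ → ι → ℝ} {b : ι → ℤ}
    (hx : Near x b) : Near (fun s => consVec (a s) (x s)) (consVec n b) := by
  obtain ⟨C, hC⟩ := hx
  -- The absolute value covers empty `ι`, where `C` may be negative while the new coordinate has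
  -- error `0`.
  refine ⟨|C|, fun s k => ?_⟩
  cases k with
  | none =>
    show |a s - s * n| ≤ |C|
    rw [ha, sub_self, abs_zero]
    exact abs_nonneg C
  | some k => exact (hC s k).trans (le_abs_self C)

/-- The real sequence `E (s m, E (s n, s b))` equals `E (s (m + n), s b)`, and it is near the rays
of both sides. -/
lemma udE_add {ι : Type} (Θ : TorusChart ι χ.X) (i : I) {E : (Option ι → ℝ) → ι → ℝ} (hE : IsLogMap (eTheta χ Θ i) E)
    (hF : IsFlow E) (m n : ℤ) (b : ι → ℤ) : udE χ Θ i m (udE χ Θ i n b) = udE χ Θ i (m + n) b := by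
  have h1 := hE.near _ _ (Near.consVec (fun s : ℕ => rfl : ∀ s : ℕ, (s : ℝ) * n = s * n) (near_ray b))
  have h2 := hE.near _ _ (Near.consVec (fun s : ℕ => rfl : ∀ s : ℕ, (s : ℝ) * m = s * m) h1)
  have h3 := hE.near _ _ (Near.consVec (n := m + n) (a := fun s : ℕ => (s : ℝ) * m + s * n)
    (fun s => by push_cast; ring) (near_ray b))
  simp only [hF.add] at h2
  exact h2.unique h3

lemma udE_zero {ι : Type} (Θ : TorusChart ι χ.X) (i : I) {E : (Option ι → ℝ) → ι → ℝ} (hE : IsLogMap (eTheta χ Θ i) E)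
    (hF : IsFlow E) (b : ι → ℤ) : udE χ Θ i 0 b = b := by
  have h1 := hE.near _ _ (Near.consVec (n := 0) (a := fun _ => 0) (fun s => by simp) (near_ray b))
  simp only [hF.zero] at h1
  exact h1.unique (near_ray b)

lemma udGamma_udE (i : I) {E : (Option ι → ℝ) → ι → ℝ} (hE : IsLogMap (eTheta χ Θ i) E)
    {G : (ι → ℝ) → κ → ℝ} (hG : IsLogMap (gammaTheta χ Θ) G) (b : ι → ℤ) :
    udGamma χ Θ (udE χ Θ i 1 b) = udGamma χ Θ b + D.coroot i := by
  have h1 := hG.near _ _ (hE.near _ _ (Near.consVec (n := 1) (a := fun s => s) (fun s => by simp)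
    (near_ray b)))
  obtain ⟨C, hC⟩ := hG.near _ _ (near_ray b)
  simp only [gamma_act χ Θ i hE hG] at h1
  refine h1.unique ⟨C, fun s k => ?_⟩
  convert hC s k using 2
  simp only [Pi.add_apply, Int.cast_add]
  show _ - (s : ℝ) * ((udGamma χ Θ b k : ℝ) + _) = _ - (s : ℝ) * (udGamma χ Θ b k : ℝ)
  ring

/-- Along the ray of `(l, b)` the parameter of each letter is exactly `s` times the pairing of its
root with `l`, so every letter carries a near-ray to a near-ray with the expected direction. -/
lemma near_wordPerm {ι : Type} (Θ : TorusChart ι χ.X) {E : I → (Option ι → ℝ) → ι → ℝ} (hE : ∀ i, IsLogMap (eTheta χ Θ i) (E i))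
    (hF : ∀ i, IsFlow (E i)) {e : I → Equiv.Perm (ι → ℤ)}
    (he : ∀ i n b, udE χ Θ i n b = (e i ^ n) b) (l : κ → ℤ) (b : ι → ℤ) (w : List I) :
    Near (fun (s : ℕ) k => wordFlow D hF w (fun k => (s : ℝ) * (Sum.elim l b k : ℤ)) (Sum.inr k))
      (wordPerm D e l w b) := by
  induction w with
  | nil => exact near_ray b
  | cons i w ih =>
    refine (congrArg (Near · _) (funext fun s => wordFlow_cons_inr D hF i w _)).mpr ?_
    have := (hE i).near _ _ (Near.consVec (n := charPairing (D.char (wordRoot A i w)) l)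
      (a := fun s : ℕ => ∑ k, (D.char (wordRoot A i w) k : ℝ) * (s * (Sum.elim l b (Sum.inl k) : ℤ)))
      (fun s => by
        simp only [charPairing, Sum.elim_inl]
        push_cast
        rw [Finset.mul_sum]
        exact Finset.sum_congr rfl fun k _ => by ring) ih)
    have h2 : wordPerm D e l (i :: w) b =
      udE χ Θ i (charPairing (D.char (wordRoot A i w)) l) (wordPerm D e l w b) := by
      rw [he]; rfl
    rw [h2]
    exact this

end Action

end

/-! ### Assembly of the free W-crystal -/

theorem theorem5p5 {I κ ι : Type} [Fintype I] [DecidableEq I] [Fintype κ] [Fintype ι]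
    (A : Matrix I I ℤ) (hA : IsSymmetrizableGCM A) (D : TorusDatum A κ)
    (χ : GeometricCrystal.{u} D) (Θ : TorusChart ι χ.X) (hΘ : IsPositiveStructure χ Θ) :
    IsFreeWCrystal D (udGamma χ Θ) (udE χ Θ) := by
  obtain ⟨G, hG⟩ := hΘ.1.exists_isLogMap
  choose E hE using fun i => (hΘ.2 i).exists_isLogMap
  have hF := fun i => act_isFlow χ Θ i (hE i)
  have hadd := fun i => udE_add χ Θ i (hE i) (hF i)
  have hzero := fun i => udE_zero χ Θ i (hE i) (hF i)
  let e : I → Equiv.Perm (ι → ℤ) := fun i =>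
    { toFun := udE χ Θ i 1
      invFun := udE χ Θ i (-1)
      left_inv := fun b => by rw [hadd, neg_add_cancel, hzero]
      right_inv := fun b => by rw [hadd, add_neg_cancel, hzero] }
  have he : ∀ i n b, udE χ Θ i n b = (e i ^ n) b := by
    intro i n b
    induction n using Int.induction_on with
    | zero => rw [hzero]; rfl
    | succ n ih =>
      rw [add_comm, ← hadd, ih, zpow_one_add]
      rfl
    | pred n ih =>
      rw [sub_eq_add_neg, add_comm, ← hadd, ih, zpow_add, zpow_neg_one]
      rfl
  refine ⟨e, he, fun i b => udGamma_udE χ Θ i (hE i) hG b, fun w l hl l' hl' c => ?_⟩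
  refine Equiv.ext fun b => ?_
  have h1 := near_wordPerm χ Θ hE hF he c b l
  have h2 := near_wordPerm χ Θ hE hF he c b l'
  -- The two words produce the same real sequence, which can be near only one ray.
  have h3 : (fun (s : ℕ) k => wordFlow D hF l (fun k => (s : ℝ) * (Sum.elim c b k : ℤ)) (Sum.inr k)) =
      fun (s : ℕ) k => wordFlow D hF l' (fun k => (s : ℝ) * (Sum.elim c b k : ℤ)) (Sum.inr k) :=
    funext fun s => wordFlow_braid χ Θ hA.diag hE hF hl hl' _
  rw [h3] at h1
  exact h1.unique h2
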